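/- Let $0<\nu\le 1$. Let $E_\nu(x)=\sum_{k\ge 0} x^k/\Gamma(k\nu+1)$ be the Mittag-Leffler function, and for $t>0$ let $$\mathrm{Ein}_\nu(t)=\int_0^t \frac{1-E_\nu(-u^\nu)}{u^\nu}\,du,\qquad \psi_\nu(t)=\Gamma(1+\nu)\,\mathrm{Ein}_\nu(t)$$ (the creep function of the generalized Becker model). Call a smooth $f:(0,\infty)\to\mathbb R$ completely monotone if $(-1)^n f^{(n)}(t)\ge 0$ for all $n\ge 0$, $t>0$, and a Bernstein function if $f\ge 0$ and $f'$ is completely monotone. Then: 1. For $t>0$, $\psi_\nu$ is differentiable with $$\psi_\nu'(t)=\Gamma(1+\nu)\,\frac{1-E_\nu(-t^\nu)}{t^\nu},$$ and this rate of creep is completely monotone on $(0,\infty)$. 2. $\psi_\nu$ is a Bernstein function. 3. The spectra of $\psi_\nu'$ exist and are non-negative. That is: the Laplace transform $F_\nu(s)=\int_0^\infty e^{-st}\psi_\nu'(t)\,dt$ converges absolutely for $\operatorname{Re}s>0$ and continues analytically to $\mathbb C\setminus(-\infty,0]$; for every $r>0$ the limits in the Titchmarsh formula $$K_\nu(r)=\lim_{\theta\to\pi^-}\frac1\pi\operatorname{Im}F_\nu(re^{-i\theta})=-\lim_{\theta\to\pi^-}\frac1\pi\operatorname{Im}F_\nu(re^{i\theta})$$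 exist and agree; and, with $H_\nu(\tau)=\tau^{-2}K_\nu(1/\tau)$, one has $K_\nu(r)\ge 0$ for all $r>0$, $H_\nu(\tau)\ge 0$ for all $\tau>0$, and $$\psi_\nu'(t)=\int_0^\infty e^{-rt}K_\nu(r)\,dr=\int_0^\infty e^{-t/\tau}H_\nu(\tau)\,d\tau\qquad(t>0),$$ with both integrals absolutely convergent. -/

import Mathlib

open Set Filter Topology MeasureTheory
open scoped ContDiff

namespace GeneralizedBecker

noncomputable section

/-- `f` is completely monotone on `(0, ∞)`: it is infinitely differentiable there and
`(-1)^n f^{(n)}(t) ≥ 0` for all `n ≥ 0`, `t > 0`. Values of `f` on `(-∞, 0]` play no role. -/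
def IsCompletelyMonotone (f : ℝ → ℝ) : Prop :=
  ContDiffOn ℝ ∞ f (Ioi 0) ∧ ∀ n : ℕ, ∀ t : ℝ, 0 < t → 0 ≤ (-1 : ℝ) ^ n * iteratedDeriv n f t

/-- `f` is a Bernstein function on `(0, ∞)`: smooth, non-negative, with completely monotone
derivative. -/
def IsBernstein (f : ℝ → ℝ) : Prop :=
  ContDiffOn ℝ ∞ f (Ioi 0) ∧ (∀ t : ℝ, 0 < t → 0 ≤ f t) ∧ IsCompletelyMonotone (deriv f)

/-- The Mittag-Leffler function `E_ν(x) = ∑ x^k / Γ(k ν + 1)`, at real arguments. -/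
def mittagLeffler (ν x : ℝ) : ℝ := ∑' k : ℕ, x ^ k / Real.Gamma (k * ν + 1)

/-- `Ein_ν(t) = ∫_0^t (1 - E_ν(-u^ν)) / u^ν du`. -/
def ein (ν t : ℝ) : ℝ := ∫ u in (0 : ℝ)..t, (1 - mittagLeffler ν (-(u ^ ν))) / u ^ ν

/-- The creep function `ψ_ν(t) = Γ(1 + ν) Ein_ν(t)`. -/
def creep (ν t : ℝ) : ℝ := Real.Gamma (1 + ν) * ein ν t

/-- The rate of creep `Γ(1 + ν) (1 - E_ν(-t^ν)) / t^ν`, for `t > 0`. -/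
def rateOfCreep (ν t : ℝ) : ℝ :=
  Real.Gamma (1 + ν) * (1 - mittagLeffler ν (-(t ^ ν))) / t ^ ν

/-- `F` is the analytic continuation to the plane cut along `(-∞, 0]` of the Laplace transform of
`f`, the latter being given by an absolutely convergent integral for `Re s > 0`. -/
def IsContinuedLaplace (f : ℝ → ℝ) (F : ℂ → ℂ) : Prop :=
  DifferentiableOn ℂ F Complex.slitPlane ∧
  ∀ s : ℂ, 0 < s.re →
    IntegrableOn (fun t : ℝ => Complex.exp (-s * (t : ℂ)) * (f t : ℂ)) (Ioi 0) ∧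
    F s = ∫ t in Ioi (0 : ℝ), Complex.exp (-s * (t : ℂ)) * (f t : ℂ)

/-- `K` is the frequency spectrum of `f` given by the Titchmarsh formula
`K(r) = ± (1/π) Im F(s)` at `s = r e^{∓ iπ}`, `r > 0`, where `F` is the analytically continued
Laplace transform of `f` and the values on the two sides of the cut are the limits of those at
`s = r e^{∓ iθ}` as `θ → π` from below. -/
def IsFrequencySpectrum (f : ℝ → ℝ) (K : ℝ → ℝ) : Prop :=
  ∃ F : ℂ → ℂ, IsContinuedLaplace f F ∧ ∀ r : ℝ, 0 < r →
    Tendsto (fun θ : ℝ => (1 / Real.pi) * (F (r * Complex.exp (-(θ * Complex.I)))).im)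
      (𝓝[<] Real.pi) (𝓝 (K r)) ∧
    Tendsto (fun θ : ℝ => -(1 / Real.pi) * (F (r * Complex.exp (θ * Complex.I))).im)
      (𝓝[<] Real.pi) (𝓝 (K r))

/-- The time spectrum `H(τ) = K(1/τ) / τ²` belonging to the frequency spectrum `K`, obtained by
the change of variable `τ = 1/r`. -/
def timeSpectrum (K : ℝ → ℝ) (τ : ℝ) : ℝ := K (1 / τ) / τ ^ 2

end

end GeneralizedBecker

/-!
Write `u(t) = E_ν(-t^ν)` for the relaxation function and `f = ψ_ν'` for the rate of creep.

Everything rests on one identity. The power series of `(1 - E_ν(-t^ν)) / t^ν` is obtained from that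
of `u` by multiplying its coefficients by Beta moments, so that
`f(t) = ν ∫_0^1 (1 - x)^{ν-1} u(xt) dx`, an average of `u(xt)` over the Beta law with parameters
`1, ν` (`rateOfCreep_eq_integral_relaxation`).

For `0 < ν < 1` the function `u` is the Laplace transform of the positive density
`M(r) = (sin νπ / π) r^{ν-1} / (r^{2ν} + 2 r^ν cos νπ + 1)` (`relaxation_eq_laplace`). By Fourier
inversion and the identity theorem it is enough to compare the Laplace transforms of both sides on
the real axis (`eq_zero_of_laplace_eq_zero`). That of `u` is summed term by term. That of the other side is the
Stieltjes transform of `M`, which Cauchy's theorem gives (`integral_relaxationSpectrum_div`): in the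
coordinate `z = log s` the cut plane is the strip `|Im z| < π`, and the contour can be a rectangle.
Averaging over `x` makes `f` the Laplace transform of the non-negative function
`K(r) = ν ∫_0^1 (1 - x)^{ν-1} M(r/x) / x dx` (`laplace_creepSpectrum`), and complete monotonicity
follows by differentiating under the integral sign. For `ν = 1` one has `u(t) = e^{-t}`, and the
density is the indicator of `(0, 1)`.

The Laplace transform of `f` continues to the cut plane as
`F(s) = (s^ν / s) J(s^ν)`, where `J(w)` is the Beta average of `1 / (w + x^ν)`, holomorphic for `w`
off the negative half-line (`isContinuedLaplace_creepTransform`). When `ν < 1`, the point `s^ν`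
stays off that half-line as `s` tends to the cut, hence the limits in the Titchmarsh formula are
values of `J`, whose imaginary part is read off as `K` (`im_logCreepTransform`). When `ν = 1`,
`F(s)` is `log (s + 1) - log s`, and the limits are limits of arguments (`tendsto_arg_one_add`). The
continuation is unique by the identity theorem, hence so is the spectrum
(`IsFrequencySpectrum.eqOn`).
-/

namespace GeneralizedBecker

/-! ### Laplace transforms -/

/-- If `e^{-σt} g(t)` is integrable on `(0, ∞)` for every real `σ > c`, then so is `e^{-st} g(t)`
for every complex `s` with `Re s > c`. -/
lemma integrableOn_laplace {g : ℝ → ℝ} {c : ℝ}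
    (hg : ∀ σ : ℝ, c < σ → IntegrableOn (fun t => Real.exp (-σ * t) * g t) (Ioi 0))
    {s : ℂ} (hs : c < s.re) :
    IntegrableOn (fun t : ℝ => Complex.exp (-s * t) * (g t : ℂ)) (Ioi 0) := by
  have h := (hg s.re hs).ofReal (𝕜 := ℂ)
  have h2 : Integrable (fun t : ℝ => Complex.exp (-(s.im * Complex.I) * t) *
      ((Real.exp (-s.re * t) * g t : ℝ) : ℂ)) (volume.restrict (Ioi 0)) := by
    refine h.bdd_mul (c := 1) (by fun_prop) (ae_of_all _ fun t => ?_)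
    have : -(s.im * Complex.I) * t = ((-(s.im * t) : ℝ) : ℂ) * Complex.I := by push_cast; ring
    rw [this, Complex.norm_exp_ofReal_mul_I]
  refine h2.congr (ae_of_all _ fun t => ?_)
  dsimp only
  push_cast
  rw [← mul_assoc, ← Complex.exp_add]
  congr 2
  nth_rewrite 3 [← Complex.re_add_im s]
  ring

lemma norm_cexp_neg_mul_ofReal (s : ℂ) (t : ℝ) :
    ‖Complex.exp (-s * t)‖ = Real.exp (-s.re * t) := by
  rw [Complex.norm_exp]; simp

/-- A Laplace transform is holomorphic in its half-plane of absolute convergence. -/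
lemma differentiableOn_laplace {g : ℝ → ℝ} {c : ℝ}
    (hg : ∀ σ : ℝ, c < σ → IntegrableOn (fun t => Real.exp (-σ * t) * g t) (Ioi 0)) :
    DifferentiableOn ℂ (fun s : ℂ => ∫ t in Ioi (0 : ℝ), Complex.exp (-s * t) * (g t : ℂ))
      {s | c < s.re} := by
  intro s hs
  have hs' : c < s.re := hs
  set δ := (s.re - c) / 3 with hδ
  have hδ0 : 0 < δ := by rw [hδ]; linarith
  have key := hasDerivAt_integral_of_dominated_loc_of_deriv_le
    (μ := volume.restrict (Ioi (0 : ℝ)))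
    (F := fun (s : ℂ) (t : ℝ) => Complex.exp (-s * t) * (g t : ℂ))
    (F' := fun (s : ℂ) (t : ℝ) => -(t : ℂ) * (Complex.exp (-s * t) * (g t : ℂ)))
    (bound := fun t => δ⁻¹ * ‖Real.exp (-(s.re - 2 * δ) * t) * g t‖)
    (x₀ := s) (s := Metric.ball s δ) (Metric.ball_mem_nhds s hδ0) ?_ ?_ ?_ ?_ ?_ ?_
  · exact key.2.differentiableAt.differentiableWithinAt
  · have : {z : ℂ | c < z.re} ∈ 𝓝 s :=
      (isOpen_lt continuous_const Complex.continuous_re).mem_nhds hs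
    filter_upwards [this] with z hz using (integrableOn_laplace hg hz).1
  · exact integrableOn_laplace hg hs
  · exact (by fun_prop : AEStronglyMeasurable (fun t : ℝ => -(t : ℂ)) _).mul
      (integrableOn_laplace hg hs).1
  · refine (ae_restrict_iff' measurableSet_Ioi).2 (ae_of_all _ fun t ht z hz => ?_)
    have ht0 : (0 : ℝ) < t := ht
    have hz' : s.re - δ ≤ z.re := by
      have h1 : |(z - s).re| ≤ ‖z - s‖ := Complex.abs_re_le_norm _
      have h2 : ‖z - s‖ < δ := by simpa [dist_eq_norm] using hz
      rw [Complex.sub_re] at h1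
      linarith [(abs_le.1 h1).1]
    rw [norm_mul, norm_neg, norm_mul, norm_cexp_neg_mul_ofReal, norm_mul, Complex.norm_real,
      Complex.norm_real, Real.norm_of_nonneg ht0.le, Real.norm_of_nonneg (Real.exp_pos _).le,
      ← mul_assoc, ← mul_assoc]
    refine mul_le_mul_of_nonneg_right ?_ (norm_nonneg _)
    -- `δ t ≤ e^{δ t}` absorbs the factor `t`
    have h3 : δ * t ≤ Real.exp (δ * t) := by linarith [Real.add_one_le_exp (δ * t)]
    have h4 : Real.exp (-z.re * t) ≤ Real.exp (-(s.re - δ) * t) := by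
      apply Real.exp_le_exp.2; nlinarith
    calc t * Real.exp (-z.re * t) = δ⁻¹ * ((δ * t) * Real.exp (-z.re * t)) := by field_simp
      _ ≤ δ⁻¹ * (Real.exp (δ * t) * Real.exp (-(s.re - δ) * t)) := by gcongr
      _ = δ⁻¹ * Real.exp (-(s.re - 2 * δ) * t) := by rw [← Real.exp_add]; ring_nf
  · exact (hg _ (by rw [hδ]; linarith)).norm.const_mul _
  · refine ae_of_all _ fun t z _ => ?_
    have h1 : HasDerivAt (fun z : ℂ => -z * t) (-(t : ℂ)) z := by
      simpa using ((hasDerivAt_id z).neg.mul_const (t : ℂ))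
    convert! h1.cexp.mul_const (g t : ℂ) using 1
    ring

/-- Identity theorem on a half-plane: agreement far out on the real axis is enough. -/
lemma eqOn_halfPlane_of_eq_real {F G : ℂ → ℂ} {c d : ℝ} (hcd : c ≤ d)
    (hF : DifferentiableOn ℂ F {s | c < s.re}) (hG : DifferentiableOn ℂ G {s | c < s.re})
    (h : ∀ σ : ℝ, d < σ → F σ = G σ) : EqOn F G {s | c < s.re} := by
  have ho : IsOpen {s : ℂ | c < s.re} := isOpen_lt continuous_const Complex.continuous_re
  have hconv : Convex ℝ {s : ℂ | c < s.re} := convex_halfSpace_re_gt c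
  refine (hF.analyticOnNhd ho).eqOn_of_preconnected_of_frequently_eq (hG.analyticOnNhd ho)
    hconv.isPreconnected (z₀ := ((d + 1 : ℝ) : ℂ)) (by simp; linarith) ?_
  have ht : Tendsto (fun n : ℕ => (((d + 1) + 1 / ((n : ℝ) + 1) : ℝ) : ℂ)) atTop
      (𝓝[≠] ((d + 1 : ℝ) : ℂ)) := by
    refine tendsto_nhdsWithin_iff.2 ⟨?_, Eventually.of_forall fun n => ?_⟩
    · refine (Complex.continuous_ofReal.tendsto _).comp ?_
      simpa using tendsto_const_nhds.add (tendsto_one_div_add_atTop_nhds_zero_nat (𝕜 := ℝ))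
    · simp only [mem_compl_iff, mem_singleton_iff, Complex.ofReal_inj]
      have : (0 : ℝ) < 1 / ((n : ℝ) + 1) := by positivity
      linarith
  refine ht.frequently (Frequently.of_forall fun n => h _ ?_)
  have : (0 : ℝ) < 1 / ((n : ℝ) + 1) := by positivity
  linarith

/-- Uniqueness for the Laplace transform: the transform is zero on a whole vertical line by the
identity theorem, and there it is the Fourier transform of `e^{-σt} g(t)`, so Fourier inversion
applies at the points of continuity of `g`. -/
lemma eq_zero_of_laplace_eq_zero {g : ℝ → ℝ} {c : ℝ} (hcont : ContinuousOn g (Ioi 0))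
    (hg : ∀ σ : ℝ, c < σ → IntegrableOn (fun t => Real.exp (-σ * t) * g t) (Ioi 0))
    (h0 : ∀ σ : ℝ, c < σ → ∫ t in Ioi (0 : ℝ), Real.exp (-σ * t) * g t = 0)
    {t : ℝ} (ht : 0 < t) : g t = 0 := by
  have hz : ∀ s : ℂ, c < s.re →
      ∫ t in Ioi (0 : ℝ), Complex.exp (-s * t) * (g t : ℂ) = 0 := by
    refine eqOn_halfPlane_of_eq_real le_rfl (differentiableOn_laplace hg)
      (differentiableOn_const (0 : ℂ)) fun σ hσ => ?_
    have := congrArg (fun x : ℝ => (x : ℂ)) (h0 σ hσ)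
    simp only [← integral_complex_ofReal] at this
    simpa using this
  set p : ℝ → ℂ := (Ioi (0 : ℝ)).indicator
    (fun t => Complex.exp (-((c + 1 : ℝ) : ℂ) * t) * (g t : ℂ)) with hp
  have hpi : Integrable p := by
    rw [hp, integrable_indicator_iff measurableSet_Ioi]
    exact integrableOn_laplace hg (by simp)
  have hF : FourierTransform.fourier p = 0 := by
    ext ξ
    rw [Real.fourier_real_eq_integral_exp_smul]
    have := hz (((c + 1 : ℝ) : ℂ) + 2 * Real.pi * ξ * Complex.I) (by simp)
    rw [← integral_indicator measurableSet_Ioi] at this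
    simp only [Pi.zero_apply]
    rw [← this]
    congr 1
    ext t
    by_cases htt : t ∈ Ioi (0 : ℝ)
    · simp only [hp, indicator_of_mem htt, smul_eq_mul]
      rw [← mul_assoc, ← Complex.exp_add]
      congr 2
      push_cast
      ring
    · simp [hp, indicator_of_notMem htt]
  have hinv := hpi.fourierInv_fourier_eq (v := t) (by rw [hF]; exact integrable_zero _ _ _) ?_
  · rw [hF] at hinv
    have h1 : p t = 0 := by
      rw [← hinv, Real.fourierInv_eq]
      simp
    simpa [hp, indicator_of_mem (show t ∈ Ioi (0 : ℝ) from ht)] using h1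
  · have hc1 : ContinuousAt (fun t : ℝ => Complex.exp (-((c + 1 : ℝ) : ℂ) * t) * (g t : ℂ)) t := by
      have := hcont.continuousAt (Ioi_mem_nhds ht)
      fun_prop
    refine hc1.congr ?_
    filter_upwards [Ioi_mem_nhds ht] with y hy
    rw [hp, indicator_of_mem hy]

/-- The Laplace transform of a non-negative density is completely monotone: it is the moment
generating function of `r ↦ -r` for that density. -/
lemma isCompletelyMonotone_of_eq_laplace {f K : ℝ → ℝ} (hK : ∀ r : ℝ, 0 < r → 0 ≤ K r)
    (hi : ∀ t : ℝ, 0 < t → IntegrableOn (fun r => Real.exp (-r * t) * K r) (Ioi 0))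
    (hf : ∀ t : ℝ, 0 < t → f t = ∫ r in Ioi (0 : ℝ), Real.exp (-r * t) * K r) :
    IsCompletelyMonotone f := by
  -- `K` inherits measurability from its integrable multiple `e^{-r} K(r)`
  have hKm : AEMeasurable K (volume.restrict (Ioi 0)) := by
    have h1 : AEMeasurable (fun r : ℝ => Real.exp (r * 1) * (Real.exp (-r * 1) * K r))
        (volume.restrict (Ioi 0)) :=
      (by fun_prop : Measurable fun r : ℝ => Real.exp (r * 1)).aemeasurable.mul
        (hi 1 one_pos).1.aemeasurable
    refine h1.congr (ae_of_all _ fun r => ?_)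
    dsimp only
    rw [← mul_assoc, ← Real.exp_add]
    simp
  set μ : Measure ℝ := (volume.restrict (Ioi 0)).withDensity (fun r => ENNReal.ofReal (K r)) with hμ
  have hae : ∀ᵐ r ∂(volume.restrict (Ioi (0 : ℝ))), 0 ≤ K r :=
    (ae_restrict_iff' measurableSet_Ioi).2 (ae_of_all _ hK)
  have hfin : ∀ᵐ r ∂(volume.restrict (Ioi (0 : ℝ))), ENNReal.ofReal (K r) < ⊤ :=
    ae_of_all _ fun _ => ENNReal.ofReal_lt_top
  have hInt : ∀ φ : ℝ → ℝ, ∫ r, φ r ∂μ = ∫ r in Ioi (0 : ℝ), φ r * K r := by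
    intro φ
    rw [hμ, integral_withDensity_eq_integral_toReal_smul₀ hKm.ennreal_ofReal hfin]
    refine integral_congr_ae ?_
    filter_upwards [hae] with r hr
    rw [ENNReal.toReal_ofReal hr, smul_eq_mul, mul_comm]
  have hsub : Ioi (0 : ℝ) ⊆ interior (ProbabilityTheory.integrableExpSet (fun r : ℝ => -r) μ) := by
    refine interior_maximal (fun t ht => ?_) isOpen_Ioi
    change Integrable (fun r : ℝ => Real.exp (t * -r)) μ
    rw [hμ, integrable_withDensity_iff_integrable_smul₀' hKm.ennreal_ofReal hfin]
    refine (hi t ht).congr ?_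
    filter_upwards [hae] with r hr
    rw [ENNReal.toReal_ofReal hr, smul_eq_mul, mul_comm]
    ring_nf
  have heq : EqOn f (ProbabilityTheory.mgf (fun r : ℝ => -r) μ) (Ioi 0) := by
    intro t ht
    rw [hf t ht, ProbabilityTheory.mgf, hInt]
    simp only [neg_mul, mul_comm t]
  refine ⟨?_, fun n t ht => ?_⟩
  · have h1 := (ProbabilityTheory.analyticOnNhd_mgf (X := fun r : ℝ => -r) (μ := μ)).mono hsub
    exact (h1.contDiffOn (uniqueDiffOn_Ioi 0)).congr heq
  · have h1 : f =ᶠ[𝓝 t] ProbabilityTheory.mgf (fun r : ℝ => -r) μ :=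
      heq.eventuallyEq_of_mem (Ioi_mem_nhds ht)
    rw [h1.iteratedDeriv_eq, ProbabilityTheory.iteratedDeriv_mgf (hsub ht), hInt,
      ← integral_const_mul]
    refine setIntegral_nonneg measurableSet_Ioi fun r hr => ?_
    have hr0 : (0 : ℝ) < r := hr
    have h2 : (-1 : ℝ) ^ n * ((-r) ^ n * Real.exp (t * -r) * K r) =
        r ^ n * Real.exp (t * -r) * K r := by
      rw [← mul_assoc, ← mul_assoc, ← mul_pow]; simp
    rw [h2]
    have := hK r hr0
    positivity

/-- The substitution `τ = 1/r` turns a frequency spectrum into the corresponding time spectrum. -/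
lemma laplace_timeSpectrum (K : ℝ → ℝ) (t : ℝ) :
    (IntegrableOn (fun τ : ℝ => Real.exp (-t / τ) * timeSpectrum K τ) (Ioi 0) ↔
      IntegrableOn (fun r : ℝ => Real.exp (-r * t) * K r) (Ioi 0)) ∧
    ∫ τ in Ioi (0 : ℝ), Real.exp (-t / τ) * timeSpectrum K τ =
      ∫ r in Ioi (0 : ℝ), Real.exp (-r * t) * K r := by
  have h : EqOn (fun x : ℝ => (|(-1 : ℝ)| * x ^ ((-1 : ℝ) - 1)) •
        (fun r : ℝ => Real.exp (-r * t) * K r) (x ^ (-1 : ℝ)))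
      (fun τ : ℝ => Real.exp (-t / τ) * timeSpectrum K τ) (Ioi 0) := by
    intro x hx
    have hx0 : (0 : ℝ) < x := hx
    have e1 : x ^ ((-1 : ℝ) - 1) = (x ^ 2)⁻¹ := by
      rw [show (-1 : ℝ) - 1 = -((2 : ℕ) : ℝ) by norm_num, Real.rpow_neg hx0.le, Real.rpow_natCast]
    simp only [e1, Real.rpow_neg_one, timeSpectrum, abs_neg, abs_one, one_mul, smul_eq_mul, one_div]
    rw [show -t / x = -x⁻¹ * t by field_simp]
    ring
  constructor
  · rw [← integrableOn_Ioi_comp_rpow_iff (fun r : ℝ => Real.exp (-r * t) * K r)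
      (by norm_num : (-1 : ℝ) ≠ 0)]
    exact (integrableOn_congr_fun h measurableSet_Ioi).symm
  · rw [← integral_comp_rpow_Ioi (fun r : ℝ => Real.exp (-r * t) * K r)
      (by norm_num : (-1 : ℝ) ≠ 0)]
    exact (setIntegral_congr_fun measurableSet_Ioi h).symm

/-! ### The Mittag-Leffler series -/

/-- The sum of an absolutely summable series of integrable functions is integrable. -/
lemma integrable_of_hasSum {α : Type*} [MeasurableSpace α] {μ : Measure α} {T : ℕ → α → ℝ}
    {f : α → ℝ} (hT : ∀ k, Integrable (T k) μ) (hs : Summable fun k => ∫ a, ‖T k a‖ ∂μ)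
    (hf : AEStronglyMeasurable f μ) (h : ∀ᵐ a ∂μ, HasSum (fun k => T k a) (f a)) :
    Integrable f μ := by
  refine ⟨hf, ?_⟩
  have h1 : ∫⁻ a, ‖f a‖ₑ ∂μ ≤ ∑' k, ∫⁻ a, ‖T k a‖ₑ ∂μ := by
    rw [← lintegral_tsum fun k => (hT k).1.enorm]
    refine lintegral_mono_ae ?_
    filter_upwards [h] with a ha
    rw [← ha.tsum_eq]
    exact enorm_tsum_le_tsum_enorm
  refine h1.trans_lt ?_
  have h2 : ∀ k, ∫⁻ a, ‖T k a‖ₑ ∂μ = ENNReal.ofReal (∫ a, ‖T k a‖ ∂μ) := fun k =>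
    (ofReal_integral_norm_eq_lintegral_enorm (hT k)).symm
  simp_rw [h2]
  exact hs.tsum_ofReal_lt_top

/-- Bound `Γ(a + 1)` below by the part of its integral over `(R, ∞)`. -/
lemma rpow_mul_exp_neg_le_Gamma {a R : ℝ} (ha : 0 ≤ a) (hR : 0 < R) :
    R ^ a * Real.exp (-R) ≤ Real.Gamma (a + 1) := by
  rw [Real.Gamma_eq_integral (by linarith)]
  have hi := Real.GammaIntegral_convergent (s := a + 1) (by linarith)
  calc R ^ a * Real.exp (-R) = ∫ x in Ioi R, R ^ a * Real.exp (-x) := by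
        rw [integral_const_mul, integral_exp_neg_Ioi]
    _ ≤ ∫ x in Ioi R, Real.exp (-x) * x ^ (a + 1 - 1) := by
        refine setIntegral_mono_on ?_ (hi.mono_set (Ioi_subset_Ioi hR.le)) measurableSet_Ioi ?_
        · exact (integrableOn_exp_neg_Ioi R).const_mul _
        · intro x hx
          have hx' : R < x := hx
          rw [mul_comm, add_sub_cancel_right]
          gcongr
    _ ≤ ∫ x in Ioi (0 : ℝ), Real.exp (-x) * x ^ (a + 1 - 1) := by
        refine setIntegral_mono_set hi ?_ (Ioi_subset_Ioi hR.le).eventuallyLE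
        refine (ae_restrict_iff' measurableSet_Ioi).2 (ae_of_all _ fun x hx => ?_)
        have hx' : (0 : ℝ) < x := hx
        simp only [Pi.zero_apply]
        positivity

/-- The Gamma function grows faster than any geometric sequence along an arithmetic progression:
in `R^a e^{-R} ≤ Γ(a+1)` take `a = kν` and `R^ν = 2T`. -/
lemma summable_pow_div_Gamma {ν : ℝ} (hν : 0 < ν) {T : ℝ} (hT : 0 ≤ T) :
    Summable fun k : ℕ => T ^ k / Real.Gamma (k * ν + 1) := by
  set R : ℝ := (2 * (T + 1)) ^ (1 / ν) with hR
  have hR0 : 0 < R := by positivity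
  have hRν : R ^ ν = 2 * (T + 1) := by
    rw [hR, ← Real.rpow_mul (by positivity), one_div_mul_cancel hν.ne', Real.rpow_one]
  refine Summable.of_nonneg_of_le (fun k => ?_) (fun k => ?_)
    ((summable_geometric_two).mul_left (Real.exp R))
  · have : 0 < Real.Gamma (k * ν + 1) := Real.Gamma_pos_of_pos (by positivity)
    positivity
  · have hG := rpow_mul_exp_neg_le_Gamma (a := k * ν) (by positivity) hR0
    have e1 : R ^ (k * ν) = 2 ^ k * (T + 1) ^ k := by
      rw [mul_comm, Real.rpow_mul hR0.le, hRν, Real.rpow_natCast, mul_pow]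
    rw [e1] at hG
    have hG0 : 0 < Real.Gamma (k * ν + 1) := Real.Gamma_pos_of_pos (by positivity)
    rw [div_le_iff₀ hG0]
    have h2 : T ^ k ≤ (T + 1) ^ k := by gcongr; linarith
    calc T ^ k ≤ (T + 1) ^ k := h2
      _ = Real.exp R * (1 / 2) ^ k * (2 ^ k * (T + 1) ^ k * Real.exp (-R)) := by
          rw [Real.exp_neg, one_div, inv_pow]; field_simp
      _ ≤ _ := by gcongr

lemma hasSum_mittagLeffler {ν : ℝ} (hν : 0 < ν) (x : ℝ) :
    HasSum (fun k : ℕ => x ^ k / Real.Gamma (k * ν + 1)) (mittagLeffler ν x) := by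
  refine Summable.hasSum (Summable.of_norm ?_)
  refine (summable_pow_div_Gamma hν (abs_nonneg x)).congr fun k => ?_
  have : 0 < Real.Gamma (k * ν + 1) := Real.Gamma_pos_of_pos (by positivity)
  rw [norm_div, norm_pow, Real.norm_eq_abs, Real.norm_of_nonneg this.le]

lemma continuous_mittagLeffler {ν : ℝ} (hν : 0 < ν) : Continuous (mittagLeffler ν) := by
  rw [continuous_iff_continuousAt]
  intro x
  have h : ContinuousOn (mittagLeffler ν) (Metric.ball x 1) := by
    refine continuousOn_tsum (u := fun k : ℕ => (|x| + 1) ^ k / Real.Gamma (k * ν + 1))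
      (fun k => by fun_prop) (summable_pow_div_Gamma hν (by positivity)) fun k y hy => ?_
    have : 0 < Real.Gamma (k * ν + 1) := Real.Gamma_pos_of_pos (by positivity)
    rw [norm_div, norm_pow, Real.norm_eq_abs, Real.norm_of_nonneg this.le]
    have h1 : |y - x| < 1 := by simpa [Real.dist_eq] using hy
    have h2 : |y| ≤ |x| + 1 := by linarith [abs_sub_abs_le_abs_sub y x]
    gcongr
  exact h.continuousAt (Metric.ball_mem_nhds x one_pos)

/-- The relaxation function `u(t) = E_ν(-t^ν)`. -/
noncomputable def relaxation (ν t : ℝ) : ℝ := mittagLeffler ν (-(t ^ ν))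

lemma continuous_relaxation {ν : ℝ} (hν : 0 < ν) : Continuous (relaxation ν) :=
  (continuous_mittagLeffler hν).comp
    (Real.continuous_rpow_const hν.le).neg

lemma hasSum_relaxation {ν : ℝ} (hν : 0 < ν) {t : ℝ} (ht : 0 ≤ t) :
    HasSum (fun k : ℕ => (-1) ^ k * t ^ (k * ν) / Real.Gamma (k * ν + 1)) (relaxation ν t) := by
  refine (hasSum_mittagLeffler hν (-(t ^ ν))).congr_fun fun k => ?_
  rw [neg_pow (t ^ ν), mul_comm (k : ℝ) ν, Real.rpow_mul ht, Real.rpow_natCast]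

lemma relaxation_one {t : ℝ} : relaxation 1 t = Real.exp (-t) := by
  rw [relaxation, mittagLeffler, Real.rpow_one, Real.exp_eq_exp_ℝ, NormedSpace.exp_eq_tsum_div]
  simp [Real.Gamma_nat_eq_factorial]

/-- Laplace transform of `t ↦ E_ν(-(xt)^ν)`, term by term; this needs `σ > x`. -/
lemma laplace_relaxation {ν : ℝ} (hν : 0 < ν) {x σ : ℝ} (hx : 0 ≤ x) (hσ : x < σ) :
    IntegrableOn (fun t => Real.exp (-σ * t) * relaxation ν (x * t)) (Ioi 0) ∧
      ∫ t in Ioi (0 : ℝ), Real.exp (-σ * t) * relaxation ν (x * t) =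
        σ ^ ν / σ / (σ ^ ν + x ^ ν) := by
  have hσ0 : 0 < σ := hx.trans_lt hσ
  set q : ℝ := (x / σ) ^ ν with hq
  have hq0 : 0 ≤ q := by positivity
  have hq1 : q < 1 := Real.rpow_lt_one (by positivity) ((div_lt_one hσ0).2 hσ) hν
  -- the `k`-th term is a Gamma integral
  set T : ℕ → ℝ → ℝ := fun k t =>
    (-1) ^ k * (x ^ (k * ν) / Real.Gamma (k * ν + 1)) * (t ^ (k * ν + 1 - 1) * Real.exp (-(σ * t)))
    with hT
  have hG : ∀ k : ℕ, 0 < Real.Gamma (k * ν + 1) := fun k => Real.Gamma_pos_of_pos (by positivity)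
  have hval : ∀ k : ℕ, ∫ t in Ioi (0 : ℝ), t ^ (k * ν + 1 - 1) * Real.exp (-(σ * t)) =
      (1 / σ) ^ (k * ν + 1) * Real.Gamma (k * ν + 1) := fun k =>
    Real.integral_rpow_mul_exp_neg_mul_Ioi (by positivity) hσ0
  -- an integral with a non-zero value is not the junk value of a divergent one
  have hI0 : ∀ k : ℕ, IntegrableOn (fun t : ℝ => t ^ (k * ν + 1 - 1) * Real.exp (-(σ * t)))
      (Ioi 0) := fun k => by
    refine (not_not.1 fun h => ?_)
    have := (hval k).symm.trans (integral_undef h)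
    have h2 := hG k
    have : 0 < (1 / σ) ^ (k * ν + 1) * Real.Gamma (k * ν + 1) := by positivity
    linarith
  have hcoef : ∀ k : ℕ, (x ^ (k * ν) / Real.Gamma (k * ν + 1)) *
      ((1 / σ) ^ (k * ν + 1) * Real.Gamma (k * ν + 1)) = σ⁻¹ * q ^ k := fun k => by
    have h2 := (hG k).ne'
    have e1 : q ^ k = x ^ (k * ν) * (1 / σ) ^ (k * ν) := by
      rw [← Real.mul_rpow hx (by positivity), mul_one_div, mul_comm (k : ℝ), Real.rpow_mul
        (by positivity), Real.rpow_natCast]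
    rw [e1, Real.rpow_add_one (by positivity)]
    field_simp
  have hTi : ∀ k : ℕ, IntegrableOn (T k) (Ioi 0) := fun k => (hI0 k).const_mul _
  have hTn : ∀ k : ℕ, ∫ t in Ioi (0 : ℝ), ‖T k t‖ = σ⁻¹ * q ^ k := fun k => by
    rw [← hcoef, ← hval, ← integral_const_mul]
    refine setIntegral_congr_fun measurableSet_Ioi fun t ht => ?_
    have ht0 : (0 : ℝ) < t := ht
    have h2 := hG k
    rw [hT, norm_mul, norm_mul, norm_pow, norm_neg, norm_one, one_pow, one_mul,
      Real.norm_of_nonneg (by positivity), Real.norm_of_nonneg (by positivity)]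
  have hTv : ∀ k : ℕ, ∫ t in Ioi (0 : ℝ), T k t = σ⁻¹ * (-q) ^ k := fun k => by
    rw [hT, integral_const_mul, hval, mul_assoc, hcoef, neg_pow q]
    ring
  have hsum : Summable fun k => ∫ t in Ioi (0 : ℝ), ‖T k t‖ := by
    simp_rw [hTn]
    exact (summable_geometric_of_lt_one hq0 hq1).mul_left _
  have hTs : ∀ t : ℝ, 0 < t →
      HasSum (fun k => T k t) (Real.exp (-σ * t) * relaxation ν (x * t)) := fun t ht => by
    refine ((hasSum_relaxation hν (mul_nonneg hx ht.le)).mul_left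
      (Real.exp (-σ * t))).congr_fun fun k => ?_
    simp only [hT]
    rw [Real.mul_rpow hx ht.le, add_sub_cancel_right, neg_mul]
    ring
  have hcongr : EqOn (fun t => ∑' k, T k t) (fun t => Real.exp (-σ * t) * relaxation ν (x * t))
    (Ioi 0) := fun t ht => (hTs t ht).tsum_eq
  constructor
  · refine integrable_of_hasSum hTi hsum ?_
      ((ae_restrict_iff' measurableSet_Ioi).2 (ae_of_all _ hTs))
    have := continuous_relaxation hν
    exact Continuous.aestronglyMeasurable (by fun_prop)
  · have h1 := hasSum_integral_of_summable_integral_norm hTi hsum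
    rw [setIntegral_congr_fun measurableSet_Ioi hcongr] at h1
    simp_rw [hTv] at h1
    have h2 := (hasSum_geometric_of_abs_lt_one (r := -q)
      (by rwa [abs_neg, abs_of_nonneg hq0])).mul_left σ⁻¹
    rw [h1.unique h2, hq, Real.div_rpow hx hσ0.le]
    have : 0 < σ ^ ν := by positivity
    have h3 : 0 ≤ x ^ ν := by positivity
    have h4 : 0 < σ ^ ν + x ^ ν := by positivity
    field_simp
    rw [sub_neg_eq_add, div_self h4.ne']

/-! ### The rate of creep as a Beta average of the relaxation function -/

lemma ae_betaMeasure (α β : ℝ) :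
    ∀ᵐ x ∂(ProbabilityTheory.betaMeasure α β), x ∈ Ioo (0 : ℝ) 1 := by
  have hm : Measurable (ProbabilityTheory.betaPDF α β) :=
    (ProbabilityTheory.measurable_betaPDFReal α β).ennreal_ofReal
  rw [ProbabilityTheory.betaMeasure, ae_withDensity_iff hm]
  refine ae_of_all _ fun x hx => ?_
  by_contra h
  exact hx (by rw [ProbabilityTheory.betaPDF_eq, if_neg (show ¬(0 < x ∧ x < 1) from h),
    ENNReal.ofReal_zero])

lemma integral_betaMeasure (α β : ℝ) (g : ℝ → ℝ) (hα : 0 < α) (hβ : 0 < β) :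
    ∫ x, g x ∂(ProbabilityTheory.betaMeasure α β) =
      ∫ x, ProbabilityTheory.betaPDFReal α β x * g x := by
  have hm : Measurable (ProbabilityTheory.betaPDF α β) :=
    (ProbabilityTheory.measurable_betaPDFReal α β).ennreal_ofReal
  rw [ProbabilityTheory.betaMeasure, integral_withDensity_eq_integral_toReal_smul hm
    (ae_of_all _ fun _ => ENNReal.ofReal_lt_top)]
  refine integral_congr_ae (ae_of_all _ fun x => ?_)
  dsimp only
  rw [smul_eq_mul, ProbabilityTheory.betaPDF, ENNReal.toReal_ofReal]
  by_cases h : 0 < x ∧ x < 1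
  · exact (ProbabilityTheory.betaPDFReal_pos h.1 h.2 hα hβ).le
  · rw [ProbabilityTheory.betaPDFReal, if_neg h]

lemma integral_rpow_betaMeasure {ν a : ℝ} (hν : 0 < ν) (ha : 0 ≤ a) :
    ∫ x, x ^ a ∂(ProbabilityTheory.betaMeasure 1 ν) =
      Real.Gamma (1 + ν) * Real.Gamma (a + 1) / Real.Gamma (a + ν + 1) := by
  have ha1 : 0 < a + 1 := by linarith
  have := ProbabilityTheory.isProbabilityMeasureBeta ha1 hν
  have h1 := integral_betaMeasure (a + 1) ν (fun _ => 1) ha1 hν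
  rw [integral_const, probReal_univ, one_smul] at h1
  rw [integral_betaMeasure 1 ν _ one_pos hν]
  -- multiplying the Beta density by `x^a` gives another Beta density, up to normalization
  have h2 : ∀ x, ProbabilityTheory.betaPDFReal 1 ν x * x ^ a =
      (ProbabilityTheory.beta (a + 1) ν / ProbabilityTheory.beta 1 ν) *
        (ProbabilityTheory.betaPDFReal (a + 1) ν x * 1) := by
    intro x
    have hb := (ProbabilityTheory.beta_pos ha1 hν).ne'
    have hb' := (ProbabilityTheory.beta_pos one_pos hν).ne'
    simp only [ProbabilityTheory.betaPDFReal]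
    split_ifs with h
    · rw [sub_self, Real.rpow_zero, add_sub_cancel_right]
      field_simp
    · simp
  simp_rw [h2]
  rw [integral_const_mul, ← h1, mul_one, ProbabilityTheory.beta, ProbabilityTheory.beta,
    Real.Gamma_one]
  have := (Real.Gamma_pos_of_pos hν).ne'
  have := (Real.Gamma_pos_of_pos (add_pos one_pos hν)).ne'
  rw [show a + 1 + ν = a + ν + 1 by ring]
  field_simp

lemma integrable_rpow_betaMeasure {ν a : ℝ} (hν : 0 < ν) (ha : 0 ≤ a) :
    Integrable (fun x => x ^ a) (ProbabilityTheory.betaMeasure 1 ν) := by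
  -- the integral is not zero, the junk value of a divergent one
  by_contra h
  have h1 := integral_rpow_betaMeasure hν ha
  rw [integral_undef h] at h1
  have := Real.Gamma_pos_of_pos (add_pos one_pos hν)
  have := Real.Gamma_pos_of_pos (show 0 < a + 1 by linarith)
  have := Real.Gamma_pos_of_pos (show 0 < a + ν + 1 by linarith)
  have : 0 < Real.Gamma (1 + ν) * Real.Gamma (a + 1) / Real.Gamma (a + ν + 1) := by positivity
  linarith

/-- The series of `(1 - E_ν(-t^ν)) / t^ν` is that of `E_ν(-(xt)^ν)` averaged over `x` with respect
to the Beta law of density `ν (1 - x)^{ν-1}` on `(0, 1)`. -/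
lemma rateOfCreep_eq_integral_relaxation {ν : ℝ} (hν : 0 < ν) {t : ℝ} (ht : 0 < t) :
    rateOfCreep ν t = ∫ x, relaxation ν (x * t) ∂(ProbabilityTheory.betaMeasure 1 ν) := by
  have hG : ∀ k : ℕ, 0 < Real.Gamma (k * ν + 1) := fun k => Real.Gamma_pos_of_pos (by positivity)
  have hG' : ∀ k : ℕ, 0 < Real.Gamma (k * ν + ν + 1) := fun k =>
    Real.Gamma_pos_of_pos (by positivity)
  have hG1 := Real.Gamma_pos_of_pos (add_pos one_pos hν)
  have htν : 0 < t ^ ν := by positivity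
  set T : ℕ → ℝ → ℝ := fun k x =>
    (-1) ^ k * (t ^ (k * ν) / Real.Gamma (k * ν + 1)) * x ^ (k * ν) with hT
  have hae := ae_betaMeasure 1 ν
  have hTi : ∀ k, Integrable (T k) (ProbabilityTheory.betaMeasure 1 ν) := fun k =>
    (integrable_rpow_betaMeasure hν (by positivity)).const_mul _
  have hval : ∀ k : ℕ, t ^ (k * ν) / Real.Gamma (k * ν + 1) *
      ∫ x, x ^ (k * ν) ∂(ProbabilityTheory.betaMeasure 1 ν) =
      Real.Gamma (1 + ν) / t ^ ν * ((t ^ ν) ^ (k + 1) / Real.Gamma ((k + 1 : ℕ) * ν + 1)) := by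
    intro k
    rw [integral_rpow_betaMeasure hν (by positivity), mul_comm (k : ℝ) ν, Real.rpow_mul ht.le,
      Real.rpow_natCast, mul_comm ν, pow_succ]
    have h1 := (hG k).ne'
    have h2 := (hG' k).ne'
    push_cast
    rw [show ((k : ℝ) + 1) * ν + 1 = k * ν + ν + 1 by ring]
    field_simp
  have hTn : ∀ k, ∫ x, ‖T k x‖ ∂(ProbabilityTheory.betaMeasure 1 ν) =
      Real.Gamma (1 + ν) / t ^ ν * ((t ^ ν) ^ (k + 1) / Real.Gamma ((k + 1 : ℕ) * ν + 1)) := by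
    intro k
    rw [← hval, ← integral_const_mul]
    refine integral_congr_ae ?_
    filter_upwards [hae] with x hx
    have hx0 := hx.1
    have h2 := hG k
    simp only [hT]
    rw [norm_mul, norm_mul, norm_pow, norm_neg, norm_one, one_pow, one_mul,
      Real.norm_of_nonneg (by positivity), Real.norm_of_nonneg (by positivity)]
  have hsum : Summable fun k => ∫ x, ‖T k x‖ ∂(ProbabilityTheory.betaMeasure 1 ν) := by
    simp_rw [hTn]
    exact ((summable_nat_add_iff 1).2 (summable_pow_div_Gamma hν htν.le)).mul_left _
  have h1 := hasSum_integral_of_summable_integral_norm hTi hsum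
  have h2 : ∫ x, (∑' k, T k x) ∂(ProbabilityTheory.betaMeasure 1 ν) =
      ∫ x, relaxation ν (x * t) ∂(ProbabilityTheory.betaMeasure 1 ν) := by
    refine integral_congr_ae ?_
    filter_upwards [hae] with x hx
    rw [← (hasSum_relaxation hν (mul_nonneg hx.1.le ht.le)).tsum_eq]
    refine tsum_congr fun k => ?_
    simp only [hT]
    rw [Real.mul_rpow hx.1.le ht.le]
    ring
  rw [h2] at h1
  refine HasSum.unique ?_ h1
  -- drop the constant term `1` of the Mittag-Leffler series and divide by `-t^ν`
  have h3 := (hasSum_nat_add_iff' 1).2 (hasSum_mittagLeffler hν (-(t ^ ν)))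
  have h4 := h3.mul_left (-(Real.Gamma (1 + ν) / t ^ ν))
  convert! h4 using 1
  · ext k
    simp only [hT]
    rw [integral_const_mul, mul_assoc, hval, neg_pow (t ^ ν)]
    ring
  · simp [rateOfCreep]
    ring

/-! ### The spectral density of the relaxation function -/

/-- The spectral density of `E_ν(-t^ν)` for `0 < ν < 1`, namely
`(sin νπ / π) r^{ν-1} / (r^{2ν} + 2 r^ν cos νπ + 1)`. -/
noncomputable def relaxationSpectrum (ν r : ℝ) : ℝ :=
  Real.sin (ν * Real.pi) / Real.pi * (r ^ ν / r) /
    ((r ^ ν) ^ 2 + 2 * r ^ ν * Real.cos (ν * Real.pi) + 1)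

lemma measurable_relaxationSpectrum (ν : ℝ) : Measurable (relaxationSpectrum ν) := by
  unfold relaxationSpectrum
  fun_prop

lemma sin_mul_pi_pos {ν : ℝ} (hν : 0 < ν) (hν1 : ν < 1) : 0 < Real.sin (ν * Real.pi) :=
  Real.sin_pos_of_pos_of_lt_pi (by positivity) (by nlinarith [Real.pi_pos])

/-- Two lower bounds for `|a + e^{iφ}|²`, good for small and for large `a`. -/
lemma sin_sq_le_quadratic (a φ : ℝ) :
    Real.sin φ ^ 2 ≤ a ^ 2 + 2 * a * Real.cos φ + 1 ∧
      a ^ 2 * Real.sin φ ^ 2 ≤ a ^ 2 + 2 * a * Real.cos φ + 1 := by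
  have h := Real.sin_sq_add_cos_sq φ
  constructor
  · nlinarith [sq_nonneg (a + Real.cos φ)]
  · nlinarith [sq_nonneg (1 + a * Real.cos φ)]

lemma relaxationSpectrum_nonneg {ν r : ℝ} (hν : 0 < ν) (hν1 : ν < 1) (hr : 0 < r) :
    0 ≤ relaxationSpectrum ν r := by
  have h1 := sin_mul_pi_pos hν hν1
  have h2 := (sin_sq_le_quadratic (r ^ ν) (ν * Real.pi)).1
  have h3 := Real.pi_pos
  have h4 : 0 < (r ^ ν) ^ 2 + 2 * r ^ ν * Real.cos (ν * Real.pi) + 1 := by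
    refine lt_of_lt_of_le ?_ h2
    positivity
  unfold relaxationSpectrum
  positivity

lemma integrableOn_relaxationSpectrum {ν : ℝ} (hν : 0 < ν) (hν1 : ν < 1) :
    IntegrableOn (relaxationSpectrum ν) (Ioi 0) := by
  have hs := sin_mul_pi_pos hν hν1
  have hpi := Real.pi_pos
  set S := Real.sin (ν * Real.pi) with hS
  -- integrable majorants near `0` and near `∞`
  have hb : ∀ r : ℝ, 0 < r → ‖relaxationSpectrum ν r‖ ≤ (Real.pi * S)⁻¹ * r ^ (ν - 1) ∧
      ‖relaxationSpectrum ν r‖ ≤ (Real.pi * S)⁻¹ * r ^ (-ν - 1) := by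
    intro r hr
    obtain ⟨h1, h2⟩ := sin_sq_le_quadratic (r ^ ν) (ν * Real.pi)
    rw [← hS] at h1 h2
    have hrν : 0 < r ^ ν := by positivity
    rw [Real.norm_of_nonneg (relaxationSpectrum_nonneg hν hν1 hr), relaxationSpectrum, ← hS,
      Real.rpow_sub hr, Real.rpow_sub hr, Real.rpow_one, Real.rpow_neg hr.le]
    constructor
    · calc _ ≤ S / Real.pi * (r ^ ν / r) / S ^ 2 := by gcongr
        _ = _ := by field_simp
    · calc _ ≤ S / Real.pi * (r ^ ν / r) / ((r ^ ν) ^ 2 * S ^ 2) := by gcongr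
        _ = _ := by field_simp
  have hm := (measurable_relaxationSpectrum ν).aestronglyMeasurable (μ := volume)
  rw [← Ioc_union_Ioi_eq_Ioi zero_le_one]
  refine IntegrableOn.union ?_ ?_
  · have h1 : IntegrableOn (fun r : ℝ => (Real.pi * S)⁻¹ * r ^ (ν - 1)) (Ioc 0 1) :=
      ((intervalIntegrable_iff_integrableOn_Ioc_of_le zero_le_one).1
        (intervalIntegral.intervalIntegrable_rpow' (by linarith))).const_mul _
    refine Integrable.mono' h1 hm.restrict ?_
    exact (ae_restrict_iff' measurableSet_Ioc).2 (ae_of_all _ fun r hr => (hb r hr.1).1)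
  · have h1 : IntegrableOn (fun r : ℝ => (Real.pi * S)⁻¹ * r ^ (-ν - 1)) (Ioi 1) :=
      (integrableOn_Ioi_rpow_of_lt (by linarith) one_pos).const_mul _
    refine Integrable.mono' h1 hm.restrict ?_
    exact (ae_restrict_iff' measurableSet_Ioi).2
      (ae_of_all _ fun r hr => (hb r (one_pos.trans hr)).2)

/-! ### The Stieltjes representation of `s^{ν-1} / (s^ν + 1)` by a contour integral -/

/-- `s^ν / (s^ν + 1)` in the logarithmic coordinate `z = log s`. -/
noncomputable def logTransform (ν : ℝ) (z : ℂ) : ℂ :=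
  Complex.exp (ν * z) / (Complex.exp (ν * z) + 1)

lemma exp_mul_add_one_ne_zero {ν : ℝ} (hν : 0 < ν) (hν1 : ν < 1) {z : ℂ} (hz : |z.im| ≤ Real.pi) :
    Complex.exp (ν * z) + 1 ≠ 0 := by
  intro h
  have h1 : Complex.exp (ν * z) = -1 := eq_neg_of_add_eq_zero_left h
  have h2 := congrArg Complex.arg h1
  have him : (ν * z).im = ν * z.im := by simp
  have hpi := Real.pi_pos
  have hlt : |ν * z.im| < Real.pi := by
    rw [abs_mul, abs_of_pos hν]
    nlinarith [abs_nonneg z.im]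
  obtain ⟨h3, h4⟩ := abs_lt.1 hlt
  rw [Complex.arg_exp, him, Complex.arg_neg_one, (toIocMod_eq_self Real.two_pi_pos).2] at h2
  · exact h4.ne h2
  · constructor <;> linarith

/-- Cauchy's theorem for the difference quotient `(Φ(z) - Φ(x₀)) / (e^z - e^{x₀})`, whose
singularity at `x₀` is removable, on the rectangle `[-R, R] × [-π, π]`. -/
lemma rect_integral_logTransform {ν : ℝ} (hν : 0 < ν) (hν1 : ν < 1) (x₀ : ℝ) {R : ℝ}
    (hR : |x₀| < R) :
    let E : ℂ → ℂ := fun z =>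
      (logTransform ν z - logTransform ν x₀) / (Complex.exp z - Complex.exp x₀)
    (∫ x in -R..R, (E (x - Real.pi * Complex.I) - E (x + Real.pi * Complex.I))) =
      Complex.I * (∫ y in -Real.pi..Real.pi, E (-R + y * Complex.I)) -
      Complex.I * (∫ y in -Real.pi..Real.pi, E (R + y * Complex.I)) := by
  intro E
  have hpi := Real.pi_pos
  have hR0 : 0 < R := (abs_nonneg _).trans_lt hR
  set Ψ : ℂ → ℂ := fun z => dslope (logTransform ν) x₀ z / dslope Complex.exp x₀ z with hΨ
  have hΨE : ∀ z : ℂ, z ≠ x₀ → Ψ z = E z := by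
    intro z hz
    have : z - x₀ ≠ 0 := sub_ne_zero.2 hz
    simp only [hΨ, E]
    rw [dslope_of_ne _ hz, dslope_of_ne _ hz, slope_def_field, slope_def_field,
      div_div_div_cancel_right₀ this]
  have hrect : ∀ z ∈ uIcc (-R) R ×ℂ uIcc (-Real.pi) Real.pi, |z.im| ≤ Real.pi := by
    intro z hz
    have := hz.2
    rw [mem_preimage, uIcc_of_le (by linarith)] at this
    exact abs_le.2 this
  have hd : DifferentiableOn ℂ Ψ (uIcc (-R) R ×ℂ uIcc (-Real.pi) Real.pi) := by
    intro z hz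
    have hzi := hrect z hz
    set U : Set ℂ := {z | Complex.exp (ν * z) + 1 ≠ 0} with hU
    have hUo : IsOpen U := isOpen_ne_fun (by fun_prop) continuous_const
    have hzU : z ∈ U := exp_mul_add_one_ne_zero hν hν1 hzi
    have hxU : (x₀ : ℂ) ∈ U := exp_mul_add_one_ne_zero hν hν1 (by simpa using hpi.le)
    have h1 : DifferentiableOn ℂ (logTransform ν) U := by
      intro w hw
      exact ((by fun_prop : DifferentiableAt ℂ (fun z : ℂ => Complex.exp (ν * z)) w).div
        (by fun_prop) (show Complex.exp (ν * w) + 1 ≠ 0 from hw)).differentiableWithinAt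
    have h2 := (Complex.differentiableOn_dslope (hUo.mem_nhds hxU)).2 h1
    have h3 : DifferentiableOn ℂ (dslope Complex.exp (x₀ : ℂ)) univ :=
      (Complex.differentiableOn_dslope univ_mem).2 Complex.differentiable_exp.differentiableOn
    refine ((h2.differentiableAt (hUo.mem_nhds hzU)).div
      (h3.differentiableAt univ_mem) ?_).differentiableWithinAt
    by_cases hzx : z = x₀
    · rw [hzx, dslope_same, Complex.deriv_exp]
      exact Complex.exp_ne_zero _
    · rw [dslope_of_ne _ hzx, slope_def_field]
      refine div_ne_zero (sub_ne_zero.2 fun h => hzx ?_) (sub_ne_zero.2 hzx)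
      -- two points of the closed strip with the same exponential, one of them real, coincide
      obtain ⟨n, hn⟩ := Complex.exp_eq_exp_iff_exists_int.1 h
      have him := congrArg Complex.im hn
      simp at him
      have hn0 : n = 0 := by
        rw [him, abs_mul, abs_of_pos (by positivity : 0 < 2 * Real.pi)] at hzi
        have : |(n : ℝ)| < 1 := by nlinarith
        have : |n| < 1 := by exact_mod_cast this
        exact Int.abs_lt_one_iff.1 this
      rw [hn, hn0]; simp
  have key := Complex.integral_boundary_rect_eq_zero_of_differentiableOn Ψ
    (-R - Real.pi * Complex.I) (R + Real.pi * Complex.I) (by simpa using hd)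
  simp only [Complex.sub_re, Complex.neg_re, Complex.ofReal_re, Complex.mul_re, Complex.I_re,
    mul_zero, Complex.ofReal_im, Complex.I_im, mul_one, sub_zero, sub_self, Complex.add_re,
    add_zero, Complex.sub_im, Complex.neg_im, neg_zero, Complex.mul_im, zero_sub, Complex.add_im,
    zero_add, smul_eq_mul, Complex.ofReal_neg, neg_mul, ← sub_eq_add_neg] at key
  have hside : ∀ x y : ℝ, (y ≠ 0 ∨ x ≠ x₀) → (x : ℂ) + y * Complex.I ≠ x₀ := by
    intro x y h he
    have h1 := congrArg Complex.re he
    have h2 := congrArg Complex.im he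
    simp at h1 h2
    tauto
  obtain ⟨hRl, hRr⟩ := abs_lt.1 hR
  have eb : ∀ x : ℝ, Ψ (x - Real.pi * Complex.I) = E (x - Real.pi * Complex.I) := fun x =>
    hΨE _ (by simpa [sub_eq_add_neg] using hside x (-Real.pi) (Or.inl (by linarith)))
  have et : ∀ x : ℝ, Ψ (x + Real.pi * Complex.I) = E (x + Real.pi * Complex.I) := fun x =>
    hΨE _ (hside x Real.pi (Or.inl hpi.ne'))
  have er : ∀ y : ℝ, Ψ (R + y * Complex.I) = E (R + y * Complex.I) := fun y =>
    hΨE _ (hside R y (Or.inr hRr.ne'))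
  have el : ∀ y : ℝ, Ψ (-R + y * Complex.I) = E (-R + y * Complex.I) := fun y =>
    hΨE _ (by simpa using hside (-R) y (Or.inr hRl.ne))
  have cont : ∀ c : ℝ, |c| ≤ Real.pi →
      IntervalIntegrable (fun x : ℝ => Ψ (x + c * Complex.I)) volume (-R) R := by
    intro c hc
    refine ContinuousOn.intervalIntegrable (hd.continuousOn.comp (by fun_prop) fun x hx => ?_)
    refine ⟨by simpa using hx, ?_⟩
    rw [mem_preimage, uIcc_of_le (by linarith)]
    simpa using abs_le.1 hc
  have hsub := intervalIntegral.integral_sub (cont (-Real.pi) (by simp [abs_of_pos hpi]))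
    (cont Real.pi (by simp [abs_of_pos hpi]))
  simp only [Complex.ofReal_neg, neg_mul, ← sub_eq_add_neg] at hsub
  rw [← hsub] at key
  simp only [eb, et, er, el] at key
  linear_combination key

/-- Across the strip, the two horizontal sides combine into the spectral density. -/
lemma logTransform_jump {ν : ℝ} (hν : 0 < ν) (hν1 : ν < 1) (x₀ x : ℝ) :
    let E : ℂ → ℂ := fun z =>
      (logTransform ν z - logTransform ν x₀) / (Complex.exp z - Complex.exp x₀)
    E (x - Real.pi * Complex.I) - E (x + Real.pi * Complex.I) =
      2 * Real.pi * Complex.I *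
        ((Real.exp x * (relaxationSpectrum ν (Real.exp x) /
          (Real.exp x₀ + Real.exp x)) : ℝ) : ℂ) := by
  intro E
  have hpi := Real.pi_pos
  have e1 : Complex.exp (x - Real.pi * Complex.I) = -Real.exp x := by
    rw [Complex.exp_sub, Complex.exp_pi_mul_I, div_neg, div_one, Complex.ofReal_exp]
  have e2 : Complex.exp (x + Real.pi * Complex.I) = -Real.exp x := by
    rw [Complex.exp_add, Complex.exp_pi_mul_I]; simp
  set φ := ν * Real.pi with hφ
  set a := Real.exp x ^ ν with ha
  have ha' : a = Real.exp (ν * x) := by rw [ha, ← Real.exp_mul, mul_comm]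
  have e3 : Complex.exp (ν * (x - Real.pi * Complex.I)) =
      a * (Real.cos φ - Real.sin φ * Complex.I) := by
    rw [show (ν : ℂ) * (x - Real.pi * Complex.I) = ((ν * x : ℝ) : ℂ) + ((-φ : ℝ) : ℂ) * Complex.I by
      rw [hφ]; push_cast; ring, Complex.exp_add, Complex.exp_mul_I, ← Complex.ofReal_exp, ← ha',
      ← Complex.ofReal_cos, ← Complex.ofReal_sin, Real.cos_neg, Real.sin_neg]
    push_cast; ring
  have e4 : Complex.exp (ν * (x + Real.pi * Complex.I)) =
      a * (Real.cos φ + Real.sin φ * Complex.I) := by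
    rw [show (ν : ℂ) * (x + Real.pi * Complex.I) = ((ν * x : ℝ) : ℂ) + ((φ : ℝ) : ℂ) * Complex.I by
      rw [hφ]; push_cast; ring, Complex.exp_add, Complex.exp_mul_I, ← Complex.ofReal_exp, ← ha',
      ← Complex.ofReal_cos, ← Complex.ofReal_sin]
  have n1 := exp_mul_add_one_ne_zero hν hν1 (z := x - Real.pi * Complex.I)
    (by simp [abs_of_pos hpi])
  have n2 := exp_mul_add_one_ne_zero hν hν1 (z := x + Real.pi * Complex.I)
    (by simp [abs_of_pos hpi])
  rw [e3] at n1
  rw [e4] at n2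
  have hs := sin_mul_pi_pos hν hν1
  rw [← hφ] at hs
  have hD : 0 < a ^ 2 + 2 * a * Real.cos φ + 1 :=
    lt_of_lt_of_le (by positivity) (sin_sq_le_quadratic a φ).1
  have hDc : (a : ℂ) ^ 2 + 2 * a * Real.cos φ + 1 ≠ 0 := by exact_mod_cast hD.ne'
  have hprod : (a * (Real.cos φ - Real.sin φ * Complex.I) + 1) *
      (a * (Real.cos φ + Real.sin φ * Complex.I) + 1) =
      (a : ℂ) ^ 2 + 2 * a * Real.cos φ + 1 := by
    have h1 : (Real.sin φ : ℂ) ^ 2 + (Real.cos φ : ℂ) ^ 2 = 1 := by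
      exact_mod_cast Real.sin_sq_add_cos_sq φ
    have h2 := Complex.I_sq
    linear_combination (a : ℂ) ^ 2 * h1 - (a : ℂ) ^ 2 * (Real.sin φ : ℂ) ^ 2 * h2
  have hsum : (Real.exp x₀ : ℂ) + Real.exp x ≠ 0 := by
    have : 0 < Real.exp x₀ + Real.exp x := by positivity
    exact_mod_cast this.ne'
  have hx0 : (Real.exp x : ℂ) ≠ 0 := by exact_mod_cast (Real.exp_pos x).ne'
  have hpic : (Real.pi : ℂ) ≠ 0 := by exact_mod_cast hpi.ne'
  simp only [E]
  rw [e1, e2, ← sub_div, sub_sub_sub_cancel_right, logTransform, logTransform, e3, e4,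
    div_sub_div _ _ n1 n2, hprod, relaxationSpectrum, ← hφ, ← ha, ← Complex.ofReal_exp x₀]
  have hden : -(Real.exp x : ℂ) - Real.exp x₀ ≠ 0 := by
    intro h; apply hsum; linear_combination -h
  push_cast at *
  generalize (a : ℂ) ^ 2 + 2 * a * Complex.cos φ + 1 = D at *
  rw [div_div, div_eq_iff (mul_ne_zero hDc hden)]
  field_simp
  ring

lemma integrable_exp_mul_comp_exp {g : ℝ → ℝ} (hg : IntegrableOn g (Ioi 0)) :
    Integrable (fun x => Real.exp x * g (Real.exp x)) ∧
      ∫ x, Real.exp x * g (Real.exp x) = ∫ r in Ioi (0 : ℝ), g r := by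
  have hd : ∀ x ∈ (univ : Set ℝ), HasDerivWithinAt Real.exp (Real.exp x) univ x := fun x _ =>
    (Real.hasDerivAt_exp x).hasDerivWithinAt
  have hinj : InjOn Real.exp univ := Real.exp_injective.injOn
  have himg : Real.exp '' univ = Ioi 0 := by rw [image_univ, Real.range_exp]
  have h1 := (integrableOn_image_iff_integrableOn_abs_deriv_smul MeasurableSet.univ hd hinj g).1
    (by rwa [himg])
  have h2 := integral_image_eq_integral_abs_deriv_smul MeasurableSet.univ hd hinj g
  rw [himg] at h2
  simp only [abs_of_pos (Real.exp_pos _), smul_eq_mul, setIntegral_univ] at h1 h2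
  exact ⟨integrableOn_univ.1 h1, h2.symm⟩

lemma integrableOn_relaxationSpectrum_div {ν : ℝ} (hν : 0 < ν) (hν1 : ν < 1) {s : ℝ} (hs : 0 < s) :
    IntegrableOn (fun r => relaxationSpectrum ν r / (s + r)) (Ioi 0) := by
  refine Integrable.mono' ((integrableOn_relaxationSpectrum hν hν1).const_mul s⁻¹)
    ((measurable_relaxationSpectrum ν).div (by fun_prop)).aestronglyMeasurable ?_
  refine (ae_restrict_iff' measurableSet_Ioi).2 (ae_of_all _ fun r hr => ?_)
  have hr0 : (0 : ℝ) < r := hr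
  have h := relaxationSpectrum_nonneg hν hν1 hr0
  rw [Real.norm_of_nonneg (by positivity), div_eq_inv_mul]
  gcongr
  linarith

/-- The left side of the contour contributes the value of `Φ` at `x₀`, as `Φ(z)` and `e^z` tend to
`0` there. -/
lemma tendsto_left_side {ν : ℝ} (hν : 0 < ν) (x₀ : ℝ) :
    Tendsto (fun R : ℝ => ∫ y in -Real.pi..Real.pi,
      (logTransform ν (-R + y * Complex.I) - logTransform ν x₀) /
        (Complex.exp (-R + y * Complex.I) - Complex.exp x₀)) atTop
      (𝓝 (2 * Real.pi * (logTransform ν x₀ / Complex.exp x₀))) := by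
  have hpi := Real.pi_pos
  have hn : ∀ c : ℝ, ∀ R y : ℝ, ‖Complex.exp (c * (-R + y * Complex.I))‖ = Real.exp (-(c * R)) := by
    intro c R y
    rw [Complex.norm_exp]; simp
  have hlim : ∀ c : ℝ, 0 < c → Tendsto (fun R : ℝ => Real.exp (-(c * R))) atTop (𝓝 0) := by
    intro c hc
    exact Real.tendsto_exp_neg_atTop_nhds_zero.comp (tendsto_id.const_mul_atTop hc)
  have hlimC : ∀ c : ℝ, 0 < c → ∀ y : ℝ,
      Tendsto (fun R : ℝ => Complex.exp (c * (-R + y * Complex.I))) atTop (𝓝 0) := by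
    intro c hc y
    rw [tendsto_zero_iff_norm_tendsto_zero]
    simp_rw [hn]
    exact hlim c hc
  have hone : ∀ R y : ℝ, Complex.exp (-R + y * Complex.I) =
      Complex.exp ((1 : ℝ) * (-R + y * Complex.I)) := fun R y => by simp
  have key := intervalIntegral.tendsto_integral_filter_of_dominated_convergence
    (μ := volume) (a := -Real.pi) (b := Real.pi) (l := atTop)
    (F := fun (R y : ℝ) => (logTransform ν (-R + y * Complex.I) - logTransform ν x₀) /
        (Complex.exp (-R + y * Complex.I) - Complex.exp x₀))
    (f := fun _ => logTransform ν x₀ / Complex.exp x₀)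
    (fun _ => (1 + ‖logTransform ν x₀‖) / (Real.exp x₀ / 2)) ?_ ?_ ?_ ?_
  · convert! key using 2
    rw [intervalIntegral.integral_const, Complex.real_smul]
    push_cast
    ring
  · refine Eventually.of_forall fun R => Measurable.aestronglyMeasurable ?_
    unfold logTransform
    fun_prop
  · filter_upwards [(hlim ν hν).eventually (ge_mem_nhds (show (0 : ℝ) < 1 / 2 by norm_num)),
      (hlim 1 one_pos).eventually (ge_mem_nhds (show 0 < Real.exp x₀ / 2 by positivity))]
      with R h1 h2
    refine ae_of_all _ fun y _ => ?_
    rw [norm_div]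
    have e1 : ‖logTransform ν (-R + y * Complex.I)‖ ≤ 1 := by
      have hge := norm_sub_le_norm_add 1 (Complex.exp (ν * (-R + y * Complex.I)))
      rw [norm_one, hn, add_comm] at hge
      rw [logTransform, norm_div, hn]
      refine div_le_one_of_le₀ ?_ (norm_nonneg _)
      linarith
    have e2 : Real.exp x₀ / 2 ≤ ‖Complex.exp (-R + y * Complex.I) - Complex.exp x₀‖ := by
      have hge := norm_sub_norm_le (Complex.exp x₀) (Complex.exp (-R + y * Complex.I))
      rw [hone, hn, norm_sub_rev, ← Complex.ofReal_exp, Complex.norm_real,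
        Real.norm_of_nonneg (Real.exp_pos _).le] at hge
      rw [hone, ← Complex.ofReal_exp]
      linarith
    gcongr
    exact (norm_sub_le _ _).trans (by gcongr)
  · exact intervalIntegrable_const
  · refine ae_of_all _ fun y _ => ?_
    have t1 := hlimC ν hν y
    have t2 := hlimC 1 one_pos y
    simp_rw [← hone] at t2
    have t3 : Tendsto (fun R : ℝ => logTransform ν (-R + y * Complex.I)) atTop (𝓝 (0 / (0 + 1))) :=
      t1.div (t1.add_const 1) (by norm_num)
    have t4 := (t3.sub_const (logTransform ν x₀)).div (t2.sub_const (Complex.exp x₀))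
      (by simp)
    simpa [Pi.div_def] using t4

/-- The right side of the contour does not contribute in the limit. -/
lemma tendsto_right_side {ν : ℝ} (hν : 0 < ν) (x₀ : ℝ) :
    Tendsto (fun R : ℝ => ∫ y in -Real.pi..Real.pi,
      (logTransform ν (R + y * Complex.I) - logTransform ν x₀) /
        (Complex.exp (R + y * Complex.I) - Complex.exp x₀)) atTop (𝓝 0) := by
  have hpi := Real.pi_pos
  have hn : ∀ c : ℝ, ∀ R y : ℝ, ‖Complex.exp (c * (R + y * Complex.I))‖ = Real.exp (c * R) := by
    intro c R y
    rw [Complex.norm_exp]; simp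
  have hone : ∀ R y : ℝ, Complex.exp (R + y * Complex.I) =
      Complex.exp ((1 : ℝ) * (R + y * Complex.I)) := fun R y => by simp
  have hlim : Tendsto (fun R : ℝ => Real.exp (ν * R)) atTop atTop :=
    Real.tendsto_exp_atTop.comp (tendsto_id.const_mul_atTop hν)
  have hlim2 : Tendsto (fun R : ℝ => (2 + ‖logTransform ν x₀‖) / (Real.exp R - Real.exp x₀) *
      |Real.pi - -Real.pi|) atTop (𝓝 0) := by
    have := ((tendsto_atTop_add_const_right atTop (-Real.exp x₀)
      Real.tendsto_exp_atTop).const_div_atTop (2 + ‖logTransform ν x₀‖)).mul_const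
        |Real.pi - -Real.pi|
    simpa [sub_eq_add_neg] using this
  refine squeeze_zero_norm' ?_ hlim2
  filter_upwards [hlim.eventually_ge_atTop 2, eventually_gt_atTop x₀] with R h1 h2
  refine intervalIntegral.norm_integral_le_of_norm_le_const fun y _ => ?_
  rw [norm_div]
  have h3 : 0 < Real.exp R - Real.exp x₀ := sub_pos.2 (Real.exp_lt_exp.2 h2)
  have e1 : ‖logTransform ν (R + y * Complex.I)‖ ≤ 2 := by
    have hge := norm_sub_le_norm_add (Complex.exp (ν * (R + y * Complex.I))) 1
    rw [norm_one, hn] at hge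
    rw [logTransform, norm_div, hn]
    refine div_le_of_le_mul₀ (norm_nonneg _) (by norm_num) ?_
    linarith
  have e2 : Real.exp R - Real.exp x₀ ≤ ‖Complex.exp (R + y * Complex.I) - Complex.exp x₀‖ := by
    have hge := norm_sub_norm_le (Complex.exp (R + y * Complex.I)) (Complex.exp x₀)
    rw [hone, hn, ← Complex.ofReal_exp, Complex.norm_real,
      Real.norm_of_nonneg (Real.exp_pos _).le, one_mul] at hge
    rwa [hone, ← Complex.ofReal_exp]
  gcongr
  exact (norm_sub_le _ _).trans (by gcongr)

/-- The Stieltjes transform of the spectral density of `E_ν(-t^ν)`. -/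
lemma integral_relaxationSpectrum_div {ν : ℝ} (hν : 0 < ν) (hν1 : ν < 1) {s : ℝ} (hs : 0 < s) :
    ∫ r in Ioi (0 : ℝ), relaxationSpectrum ν r / (s + r) = s ^ ν / s / (s ^ ν + 1) := by
  set x₀ := Real.log s with hx₀
  have hsx : Real.exp x₀ = s := Real.exp_log hs
  obtain ⟨hi, hv⟩ := integrable_exp_mul_comp_exp (integrableOn_relaxationSpectrum_div hν hν1 hs)
  have hiC : Integrable (fun x =>
      ((Real.exp x * (relaxationSpectrum ν (Real.exp x) / (s + Real.exp x)) : ℝ) : ℂ)) := hi.ofReal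
  have h1 := intervalIntegral_tendsto_integral hiC
    (tendsto_neg_atTop_atBot (G := ℝ)) tendsto_id
  have h2 := h1.const_mul (2 * Real.pi * Complex.I)
  have h3 := ((tendsto_left_side hν x₀).const_mul Complex.I).sub
    ((tendsto_right_side hν x₀).const_mul Complex.I)
  have h4 := tendsto_nhds_unique (h2.congr' ?_) h3
  · -- compare the limits `2πi ∫ M(r)/(s+r) dr` and `2πi Φ(x₀)/s` of the two sides of the identity
    have hsν : Complex.exp (ν * x₀) = ((s ^ ν : ℝ) : ℂ) := by
      rw [← hsx, ← Real.exp_mul, mul_comm x₀]; push_cast; rfl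
    rw [integral_complex_ofReal, hv, logTransform, hsν, ← Complex.ofReal_exp, hsx, mul_zero,
      sub_zero] at h4
    have hc : (2 * Real.pi * Complex.I : ℂ) ≠ 0 := by
      simp [Real.pi_ne_zero, Complex.I_ne_zero]
    have h5 : ((∫ r in Ioi (0 : ℝ), relaxationSpectrum ν r / (s + r) : ℝ) : ℂ) =
        ((s ^ ν / s / (s ^ ν + 1) : ℝ) : ℂ) := by
      refine mul_left_cancel₀ hc (h4.trans ?_)
      push_cast
      rw [div_right_comm]
      ring
    exact_mod_cast h5
  · filter_upwards [eventually_gt_atTop |x₀|] with R hR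
    have := rect_integral_logTransform hν hν1 x₀ hR
    rw [← this, ← intervalIntegral.integral_const_mul]
    refine intervalIntegral.integral_congr fun x _ => ?_
    have hj := logTransform_jump hν hν1 x₀ x
    dsimp only at hj ⊢
    rw [hj, hsx]

/-- The Laplace transform of the spectral density exists and is continuous; by Fubini, applying the
Laplace transform once more yields the Stieltjes transform. -/
lemma laplace_laplace_relaxationSpectrum {ν : ℝ} (hν : 0 < ν) (hν1 : ν < 1) :
    (∀ t : ℝ, 0 ≤ t → IntegrableOn (fun r => Real.exp (-r * t) * relaxationSpectrum ν r) (Ioi 0)) ∧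
    ContinuousOn (fun t => ∫ r in Ioi (0 : ℝ), Real.exp (-r * t) * relaxationSpectrum ν r) (Ici 0) ∧
    ∀ σ : ℝ, 0 < σ →
      IntegrableOn (fun t => Real.exp (-σ * t) *
        ∫ r in Ioi (0 : ℝ), Real.exp (-r * t) * relaxationSpectrum ν r) (Ioi 0) ∧
      ∫ t in Ioi (0 : ℝ), Real.exp (-σ * t) *
        ∫ r in Ioi (0 : ℝ), Real.exp (-r * t) * relaxationSpectrum ν r =
          σ ^ ν / σ / (σ ^ ν + 1) := by
  have hM := integrableOn_relaxationSpectrum hν hν1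
  have hMm := measurable_relaxationSpectrum ν
  have hb : ∀ t : ℝ, 0 ≤ t → ∀ᵐ r ∂(volume.restrict (Ioi (0 : ℝ))),
      ‖Real.exp (-r * t) * relaxationSpectrum ν r‖ ≤ relaxationSpectrum ν r := by
    intro t ht
    refine (ae_restrict_iff' measurableSet_Ioi).2 (ae_of_all _ fun r hr => ?_)
    have hr0 : (0 : ℝ) < r := hr
    have h := relaxationSpectrum_nonneg hν hν1 hr0
    rw [Real.norm_of_nonneg (by positivity)]
    refine mul_le_of_le_one_left h (Real.exp_le_one_iff.2 ?_)
    nlinarith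
  have hm : ∀ t : ℝ, AEStronglyMeasurable (fun r => Real.exp (-r * t) * relaxationSpectrum ν r)
      (volume.restrict (Ioi 0)) := fun t =>
    ((by fun_prop : Measurable fun r : ℝ => Real.exp (-r * t)).mul hMm).aestronglyMeasurable
  refine ⟨fun t ht => Integrable.mono' hM (hm t) (hb t ht), ?_, fun σ hσ => ?_⟩
  · refine continuousOn_of_dominated (bound := relaxationSpectrum ν) (fun t _ => hm t)
      (fun t ht => hb t ht) hM (ae_of_all _ fun r => ?_)
    fun_prop
  · have hexp : ∀ r : ℝ, 0 < r → IntegrableOn (fun t : ℝ => Real.exp (-(σ + r) * t)) (Ioi 0) ∧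
        ∫ t in Ioi (0 : ℝ), Real.exp (-(σ + r) * t) = (σ + r)⁻¹ := by
      intro r hr
      have h0 : -(σ + r) < 0 := by linarith
      refine ⟨integrableOn_exp_mul_Ioi h0 0, ?_⟩
      rw [integral_exp_mul_Ioi h0]
      rw [mul_zero, Real.exp_zero, neg_div_neg_eq, one_div]
    set G : ℝ → ℝ → ℝ := fun t r => Real.exp (-(σ + r) * t) * relaxationSpectrum ν r with hG
    have hGm : Measurable (Function.uncurry G) := by
      refine Measurable.mul (by fun_prop) (hMm.comp measurable_snd)
    have hval : ∀ r : ℝ, 0 < r →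
        ∫ t in Ioi (0 : ℝ), G t r = relaxationSpectrum ν r / (σ + r) := by
      intro r hr
      simp only [hG]
      rw [integral_mul_const, (hexp r hr).2, div_eq_inv_mul]
    have hprod : Integrable (Function.uncurry G)
        ((volume.restrict (Ioi (0 : ℝ))).prod (volume.restrict (Ioi (0 : ℝ)))) := by
      rw [integrable_prod_iff' hGm.aestronglyMeasurable]
      constructor
      · refine (ae_restrict_iff' measurableSet_Ioi).2 (ae_of_all _ fun r hr => ?_)
        exact (hexp r hr).1.mul_const (relaxationSpectrum ν r)
      · refine (integrableOn_relaxationSpectrum_div hν hν1 hσ).congr ?_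
        refine (ae_restrict_iff' measurableSet_Ioi).2 (ae_of_all _ fun r hr => ?_)
        dsimp only
        rw [← hval r hr]
        refine integral_congr_ae (ae_of_all _ fun t => ?_)
        have h := relaxationSpectrum_nonneg hν hν1 hr
        simp only [Function.uncurry_apply_pair, hG]
        rw [Real.norm_of_nonneg (by positivity)]
    have hin : ∀ t : ℝ, ∫ r in Ioi (0 : ℝ), G t r = Real.exp (-σ * t) *
        ∫ r in Ioi (0 : ℝ), Real.exp (-r * t) * relaxationSpectrum ν r := by
      intro t
      rw [← integral_const_mul]
      refine integral_congr_ae (ae_of_all _ fun r => ?_)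
      simp only [hG]
      rw [← mul_assoc, ← Real.exp_add]
      ring_nf
    constructor
    · exact hprod.integral_prod_left.congr (ae_of_all _ hin)
    · rw [← integral_relaxationSpectrum_div hν hν1 hσ,
        ← integral_congr_ae (ae_of_all _ hin), integral_integral_swap hprod]
      exact setIntegral_congr_fun measurableSet_Ioi hval

/-- `E_ν(-t^ν)` is the Laplace transform of its spectral density, because the two functions have
the same Laplace transform. -/
lemma relaxation_eq_laplace {ν : ℝ} (hν : 0 < ν) (hν1 : ν < 1) {t : ℝ} (ht : 0 < t) :
    relaxation ν t = ∫ r in Ioi (0 : ℝ), Real.exp (-r * t) * relaxationSpectrum ν r := by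
  obtain ⟨-, hc, hL⟩ := laplace_laplace_relaxationSpectrum hν hν1
  have hL' : ∀ σ : ℝ, 1 < σ → _ := fun σ hσ => laplace_relaxation hν (x := 1) zero_le_one hσ
  simp only [one_mul, Real.one_rpow] at hL'
  refine sub_eq_zero.1 (eq_zero_of_laplace_eq_zero (c := 1) (g := fun t => relaxation ν t -
    ∫ r in Ioi (0 : ℝ), Real.exp (-r * t) * relaxationSpectrum ν r) ?_ ?_ ?_ ht)
  · exact (continuous_relaxation hν).continuousOn.sub (hc.mono Ioi_subset_Ici_self)
  · intro σ hσ
    simp_rw [mul_sub]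
    exact (hL' σ hσ).1.sub (hL σ (one_pos.trans hσ)).1
  · intro σ hσ
    simp_rw [mul_sub]
    rw [integral_sub (hL' σ hσ).1 (hL σ (one_pos.trans hσ)).1, (hL' σ hσ).2,
      (hL σ (one_pos.trans hσ)).2, sub_self]

/-! ### The Laplace transform of the rate of creep and its continuation -/

lemma exp_mem_slitPlane {z : ℂ} (hz : |z.im| < Real.pi) : Complex.exp z ∈ Complex.slitPlane := by
  obtain ⟨h1, h2⟩ := abs_lt.1 hz
  refine Complex.mem_slitPlane_iff_arg.2 ⟨?_, Complex.exp_ne_zero z⟩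
  rw [← Complex.log_im, Complex.log_exp h1 h2.le]
  exact h2.ne

lemma exp_cpow {ν : ℝ} {z : ℂ} (hz : |z.im| < Real.pi) :
    Complex.exp z ^ (ν : ℂ) = Complex.exp (ν * z) := by
  obtain ⟨h1, h2⟩ := abs_lt.1 hz
  rw [Complex.cpow_def_of_ne_zero (Complex.exp_ne_zero z), Complex.log_exp h1 h2.le, mul_comm]

lemma cpow_mem_slitPlane {ν : ℝ} (hν : 0 < ν) (hν1 : ν ≤ 1) {s : ℂ} (hs : s ∈ Complex.slitPlane) :
    s ^ (ν : ℂ) ∈ Complex.slitPlane := by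
  have h0 := Complex.slitPlane_ne_zero hs
  rw [Complex.cpow_def_of_ne_zero h0]
  refine exp_mem_slitPlane ?_
  have h1 : |s.arg| < Real.pi := abs_lt.2 ⟨Complex.neg_pi_lt_arg s,
    lt_of_le_of_ne (Complex.arg_le_pi s) (Complex.mem_slitPlane_iff_arg.1 hs).1⟩
  have h2 : (Complex.log s * ν).im = s.arg * ν := by simp [Complex.log_im]
  rw [h2, abs_mul, abs_of_pos hν]
  nlinarith [abs_nonneg s.arg]

/-- The Stieltjes transform `∫ dμ(x) / (w + y(x))` of the law of a non-negative function `y` is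
holomorphic off the negative half-line. -/
lemma differentiableOn_integral_inv_add {μ : Measure ℝ} [IsFiniteMeasure μ] {y : ℝ → ℝ}
    (hm : Measurable y) (hy : ∀ᵐ x ∂μ, 0 ≤ y x) :
    (∀ w ∈ Complex.slitPlane, Integrable (fun x => (w + y x)⁻¹) μ) ∧
    DifferentiableOn ℂ (fun w : ℂ => ∫ x, (w + y x)⁻¹ ∂μ) Complex.slitPlane := by
  have hmeas : ∀ w : ℂ, Measurable fun x => (w + (y x : ℂ))⁻¹ := fun w => by fun_prop
  -- `-a` is not in the slit plane, so `z + a` is bounded below by the distance to the cut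
  have hball : ∀ w ∈ Complex.slitPlane, ∃ δ > 0, ∀ z ∈ Metric.ball w δ, ∀ a : ℝ, 0 ≤ a →
      δ ≤ ‖z + a‖ := by
    intro w hw
    obtain ⟨ε, hε, hb⟩ := Metric.isOpen_iff.1 Complex.isOpen_slitPlane w hw
    refine ⟨ε / 2, half_pos hε, fun z hz a ha => ?_⟩
    have h1 : (-(a : ℂ)) ∉ Complex.slitPlane := by
      simp [Complex.mem_slitPlane_iff, ha]
    have h2 : ε ≤ dist (-(a : ℂ)) w := by
      by_contra h
      exact h1 (hb (by simpa using h))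
    have h3 : dist (-(a : ℂ)) w ≤ dist (-(a : ℂ)) z + dist z w := dist_triangle _ _ _
    have h4 : dist (-(a : ℂ)) z = ‖z + a‖ := by
      rw [dist_comm, dist_eq_norm, sub_neg_eq_add]
    have h5 : dist z w < ε / 2 := hz
    linarith
  have hint : ∀ w ∈ Complex.slitPlane, Integrable (fun x => (w + (y x : ℂ))⁻¹) μ := by
    intro w hw
    obtain ⟨δ, hδ, hb⟩ := hball w hw
    refine Integrable.of_bound (hmeas w).aestronglyMeasurable δ⁻¹ ?_
    filter_upwards [hy] with x hx
    rw [norm_inv]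
    exact inv_anti₀ hδ (hb w (Metric.mem_ball_self hδ) _ hx)
  refine ⟨hint, fun w hw => ?_⟩
  obtain ⟨δ, hδ, hb⟩ := hball w hw
  have key := hasDerivAt_integral_of_dominated_loc_of_deriv_le (μ := μ)
    (F := fun (w : ℂ) x => (w + (y x : ℂ))⁻¹) (F' := fun (w : ℂ) x => -1 / (w + (y x : ℂ)) ^ 2)
    (bound := fun _ => 1 / δ ^ 2) (x₀ := w) (s := Metric.ball w δ)
    (Metric.ball_mem_nhds w hδ) ?_ (hint w hw) ?_ ?_ (integrable_const _) ?_
  · exact key.2.differentiableAt.differentiableWithinAt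
  · exact Eventually.of_forall fun z => (hmeas z).aestronglyMeasurable
  · exact Measurable.aestronglyMeasurable (by fun_prop)
  · filter_upwards [hy] with x hx z hz
    have := hb z hz _ hx
    rw [norm_div, norm_neg, norm_one, norm_pow]
    gcongr
  · filter_upwards [hy] with x hx z hz
    have h1 : z + (y x : ℂ) ≠ 0 := norm_pos_iff.1 (hδ.trans_le (hb z hz _ hx))
    exact ((hasDerivAt_id z).add_const _).inv h1

/-- The continued Laplace transform of the rate of creep,
`F(s) = ν ∫_0^1 (1-x)^{ν-1} s^{ν-1} / (s^ν + x^ν) dx`, with the weight `ν (1-x)^{ν-1}` expressed as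
a Beta law. -/
noncomputable def creepTransform (ν : ℝ) (s : ℂ) : ℂ :=
  s ^ (ν : ℂ) / s *
    ∫ x, (s ^ (ν : ℂ) + ((x ^ ν : ℝ) : ℂ))⁻¹ ∂(ProbabilityTheory.betaMeasure 1 ν)

lemma ae_rpow_nonneg (ν : ℝ) : ∀ᵐ x ∂(ProbabilityTheory.betaMeasure 1 ν), 0 ≤ x ^ ν := by
  filter_upwards [ae_betaMeasure 1 ν] with x hx
  exact Real.rpow_nonneg hx.1.le ν

lemma differentiableOn_stieltjes_betaMeasure {ν : ℝ} (hν : 0 < ν) :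
    (∀ w ∈ Complex.slitPlane, Integrable (fun x : ℝ => (w + ((x ^ ν : ℝ) : ℂ))⁻¹)
      (ProbabilityTheory.betaMeasure 1 ν)) ∧
    DifferentiableOn ℂ (fun w : ℂ => ∫ x, (w + ((x ^ ν : ℝ) : ℂ))⁻¹
      ∂(ProbabilityTheory.betaMeasure 1 ν)) Complex.slitPlane := by
  have := ProbabilityTheory.isProbabilityMeasureBeta one_pos hν
  exact differentiableOn_integral_inv_add (by fun_prop) (ae_rpow_nonneg ν)

lemma differentiableOn_creepTransform {ν : ℝ} (hν : 0 < ν) (hν1 : ν ≤ 1) :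
    DifferentiableOn ℂ (creepTransform ν) Complex.slitPlane := by
  have hp : DifferentiableOn ℂ (fun s : ℂ => s ^ (ν : ℂ)) Complex.slitPlane := fun s hs =>
    (differentiableAt_id.cpow_const hs).differentiableWithinAt
  exact (hp.div differentiableOn_id fun s hs => Complex.slitPlane_ne_zero hs).mul
    ((differentiableOn_stieltjes_betaMeasure hν).2.comp hp fun s hs =>
      cpow_mem_slitPlane hν hν1 hs)

lemma exists_bound_relaxation {ν : ℝ} (hν : 0 < ν) (hν1 : ν ≤ 1) :
    ∃ B, ∀ t : ℝ, 0 < t → |relaxation ν t| ≤ B := by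
  rcases hν1.lt_or_eq with h | rfl
  · refine ⟨∫ r in Ioi (0 : ℝ), relaxationSpectrum ν r, fun t ht => ?_⟩
    rw [relaxation_eq_laplace hν h ht, ← Real.norm_eq_abs]
    refine norm_integral_le_of_norm_le (integrableOn_relaxationSpectrum hν h) ?_
    refine (ae_restrict_iff' measurableSet_Ioi).2 (ae_of_all _ fun r hr => ?_)
    have hr0 : (0 : ℝ) < r := hr
    have h := relaxationSpectrum_nonneg hν h hr0
    rw [Real.norm_of_nonneg (by positivity)]
    refine mul_le_of_le_one_left h (Real.exp_le_one_iff.2 ?_)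
    nlinarith
  · refine ⟨1, fun t ht => ?_⟩
    rw [relaxation_one, abs_of_pos (Real.exp_pos _), Real.exp_le_one_iff]
    linarith

lemma exists_bound_rateOfCreep {ν : ℝ} (hν : 0 < ν) (hν1 : ν ≤ 1) :
    ∃ B, ∀ t : ℝ, 0 < t → |rateOfCreep ν t| ≤ B := by
  obtain ⟨B, hB⟩ := exists_bound_relaxation hν hν1
  have := ProbabilityTheory.isProbabilityMeasureBeta one_pos hν
  refine ⟨B, fun t ht => ?_⟩
  rw [rateOfCreep_eq_integral_relaxation hν ht, ← Real.norm_eq_abs]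
  refine (norm_integral_le_of_norm_le_const (C := B) ?_).trans (by simp)
  filter_upwards [ae_betaMeasure 1 ν] with x hx
  exact hB _ (mul_pos hx.1 ht)

lemma continuousOn_rateOfCreep {ν : ℝ} (hν : 0 < ν) : ContinuousOn (rateOfCreep ν) (Ioi 0) := by
  have h1 := continuous_relaxation hν
  unfold relaxation at h1
  have h2 := Real.continuous_rpow_const hν.le
  refine ContinuousOn.div (continuous_const.mul (continuous_const.sub h1)).continuousOn
    h2.continuousOn fun t ht => ?_
  exact (Real.rpow_pos_of_pos ht ν).ne'

lemma integrableOn_exp_mul_rateOfCreep {ν : ℝ} (hν : 0 < ν) (hν1 : ν ≤ 1) {σ : ℝ} (hσ : 0 < σ) :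
    IntegrableOn (fun t => Real.exp (-σ * t) * rateOfCreep ν t) (Ioi 0) := by
  obtain ⟨B, hB⟩ := exists_bound_rateOfCreep hν hν1
  refine Integrable.mul_bdd (c := B) (integrableOn_exp_mul_Ioi (neg_neg_of_pos hσ) 0)
    ((continuousOn_rateOfCreep hν).aestronglyMeasurable measurableSet_Ioi) ?_
  exact (ae_restrict_iff' measurableSet_Ioi).2 (ae_of_all _ hB)

/-- The Laplace transform of the rate of creep on `(1, ∞)`, where that of `u(xt)` can be summed term
by term for all `x` in `(0, 1)`. -/
lemma laplace_rateOfCreep {ν : ℝ} (hν : 0 < ν) (hν1 : ν ≤ 1) {σ : ℝ} (hσ : 1 < σ) :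
    ∫ t in Ioi (0 : ℝ), Real.exp (-σ * t) * rateOfCreep ν t =
      ∫ x, σ ^ ν / σ / (σ ^ ν + x ^ ν) ∂(ProbabilityTheory.betaMeasure 1 ν) := by
  have := ProbabilityTheory.isProbabilityMeasureBeta one_pos hν
  obtain ⟨B, hB⟩ := exists_bound_relaxation hν hν1
  have hae := ae_betaMeasure 1 ν
  set G : ℝ → ℝ → ℝ := fun t x => Real.exp (-σ * t) * relaxation ν (x * t) with hG
  have hGc : Continuous (Function.uncurry G) := by
    have := continuous_relaxation hν
    exact (by fun_prop : Continuous fun p : ℝ × ℝ => Real.exp (-σ * p.1) * relaxation ν (p.2 * p.1))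
  have hprod : Integrable (Function.uncurry G)
      ((volume.restrict (Ioi (0 : ℝ))).prod (ProbabilityTheory.betaMeasure 1 ν)) := by
    have h1 : Integrable (fun t : ℝ => Real.exp (-σ * t) * B) (volume.restrict (Ioi (0 : ℝ))) :=
      (integrableOn_exp_mul_Ioi (by linarith) 0).mul_const B
    refine Integrable.mono' (h1.comp_fst _) hGc.aestronglyMeasurable ?_
    have m1 : ∀ᵐ p ∂((volume.restrict (Ioi (0 : ℝ))).prod (ProbabilityTheory.betaMeasure 1 ν)),
        p.1 ∈ Ioi (0 : ℝ) :=
      Measure.quasiMeasurePreserving_fst.ae (ae_restrict_mem measurableSet_Ioi)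
    have m2 : ∀ᵐ p ∂((volume.restrict (Ioi (0 : ℝ))).prod (ProbabilityTheory.betaMeasure 1 ν)),
        p.2 ∈ Ioo (0 : ℝ) 1 := Measure.quasiMeasurePreserving_snd.ae hae
    filter_upwards [m1, m2] with p h1 h2
    simp only [Function.uncurry, hG, norm_mul, Real.norm_of_nonneg (Real.exp_pos _).le]
    gcongr
    exact hB _ (mul_pos h2.1 h1)
  calc ∫ t in Ioi (0 : ℝ), Real.exp (-σ * t) * rateOfCreep ν t
      = ∫ t in Ioi (0 : ℝ), ∫ x, G t x ∂(ProbabilityTheory.betaMeasure 1 ν) := by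
        refine setIntegral_congr_fun measurableSet_Ioi fun t ht => ?_
        simp only [hG]
        rw [integral_const_mul, rateOfCreep_eq_integral_relaxation hν ht]
    _ = ∫ x, (∫ t in Ioi (0 : ℝ), G t x) ∂(ProbabilityTheory.betaMeasure 1 ν) :=
        integral_integral_swap hprod
    _ = _ := by
        refine integral_congr_ae ?_
        filter_upwards [hae] with x hx
        exact (laplace_relaxation hν hx.1.le (hx.2.trans hσ)).2

lemma isContinuedLaplace_creepTransform {ν : ℝ} (hν : 0 < ν) (hν1 : ν ≤ 1) :
    IsContinuedLaplace (rateOfCreep ν) (creepTransform ν) := by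
  have hd := differentiableOn_creepTransform hν hν1
  have hi : ∀ σ : ℝ, 0 < σ → _ := fun σ hσ => integrableOn_exp_mul_rateOfCreep hν hν1 hσ
  have heq := eqOn_halfPlane_of_eq_real (c := 0) (d := 1) (F := creepTransform ν) zero_le_one
    (hd.mono fun s hs => Or.inl hs) (differentiableOn_laplace hi) ?_
  · exact ⟨hd, fun s hs => ⟨integrableOn_laplace hi hs, heq hs⟩⟩
  · intro σ hσ
    have h0 : 0 < σ := by linarith
    have h1 : ∫ t in Ioi (0 : ℝ), Complex.exp (-(σ : ℂ) * t) * (rateOfCreep ν t : ℂ) =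
        ((∫ t in Ioi (0 : ℝ), Real.exp (-σ * t) * rateOfCreep ν t : ℝ) : ℂ) := by
      rw [← integral_complex_ofReal]
      simp
    rw [h1, laplace_rateOfCreep hν hν1 hσ, ← integral_complex_ofReal, creepTransform,
      ← integral_const_mul]
    refine integral_congr_ae (ae_of_all _ fun x => ?_)
    dsimp only
    rw [← Complex.ofReal_cpow h0.le]
    push_cast
    rw [div_eq_mul_inv (_ / _)]

/-- Two continuations to the cut plane of the same Laplace transform coincide. -/
lemma IsContinuedLaplace.eqOn {f : ℝ → ℝ} {F G : ℂ → ℂ} (hF : IsContinuedLaplace f F)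
    (hG : IsContinuedLaplace f G) : EqOn F G Complex.slitPlane := by
  refine (hF.1.analyticOnNhd Complex.isOpen_slitPlane).eqOn_of_preconnected_of_eventuallyEq
    (hG.1.analyticOnNhd Complex.isOpen_slitPlane)
    (Complex.starConvex_one_slitPlane.isPathConnected
      Complex.one_mem_slitPlane).isConnected.isPreconnected Complex.one_mem_slitPlane ?_
  filter_upwards [(isOpen_lt continuous_const Complex.continuous_re).mem_nhds
    (show (0 : ℝ) < (1 : ℂ).re by simp)] with s hs
  rw [(hF.2 s hs).2, (hG.2 s hs).2]

/-- The Titchmarsh formula determines the spectrum on `(0, ∞)`. -/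
lemma IsFrequencySpectrum.eqOn {f K L : ℝ → ℝ} (hK : IsFrequencySpectrum f K)
    (hL : IsFrequencySpectrum f L) : EqOn K L (Ioi 0) := by
  obtain ⟨F, hF, hFK⟩ := hK
  obtain ⟨G, hG, hGL⟩ := hL
  intro r hr
  have hr0 : (0 : ℝ) < r := hr
  refine tendsto_nhds_unique (hFK r hr).1 ((hGL r hr).1.congr' ?_)
  filter_upwards [Ioo_mem_nhdsLT Real.pi_pos] with θ hθ
  have hmem : (r : ℂ) * Complex.exp (-(θ * Complex.I)) ∈ Complex.slitPlane := by
    have h : (r : ℂ) * Complex.exp (-(θ * Complex.I)) =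
        Complex.exp (Real.log r + -(θ * Complex.I)) := by
      rw [Complex.exp_add, ← Complex.ofReal_exp, Real.exp_log hr0]
    rw [h]
    refine exp_mem_slitPlane ?_
    simpa [abs_of_pos hθ.1] using hθ.2
  rw [hF.eqOn hG hmem]

/-! ### The frequency spectrum -/

/-- The frequency spectrum of the rate of creep for `0 < ν < 1`: the Beta average of the spectral
densities of the rescaled relaxation functions `t ↦ E_ν(-(xt)^ν)`. -/
noncomputable def creepSpectrum (ν r : ℝ) : ℝ :=
  ∫ x, relaxationSpectrum ν (r / x) / x ∂(ProbabilityTheory.betaMeasure 1 ν)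

lemma creepSpectrum_nonneg {ν r : ℝ} (hν : 0 < ν) (hν1 : ν < 1) (hr : 0 < r) :
    0 ≤ creepSpectrum ν r := by
  refine integral_nonneg_of_ae ?_
  filter_upwards [ae_betaMeasure 1 ν] with x hx
  exact div_nonneg (relaxationSpectrum_nonneg hν hν1 (div_pos hr hx.1)) hx.1.le

/-- Fubini for the Beta average of `u(xt) = ∫_0^∞ e^{-rxt} M(r) dr`, after rescaling `r`. -/
lemma laplace_creepSpectrum {ν : ℝ} (hν : 0 < ν) (hν1 : ν < 1) {t : ℝ} (ht : 0 < t) :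
    IntegrableOn (fun r => Real.exp (-r * t) * creepSpectrum ν r) (Ioi 0) ∧
      rateOfCreep ν t = ∫ r in Ioi (0 : ℝ), Real.exp (-r * t) * creepSpectrum ν r := by
  have := ProbabilityTheory.isProbabilityMeasureBeta one_pos hν
  have hae := ae_betaMeasure 1 ν
  obtain ⟨B, hB⟩ := exists_bound_relaxation hν hν1.le
  have hM := (laplace_laplace_relaxationSpectrum hν hν1).1
  set G : ℝ → ℝ → ℝ := fun x r => Real.exp (-r * t) * (relaxationSpectrum ν (r / x) / x) with hG
  have hGm : Measurable (Function.uncurry G) := by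
    refine Measurable.mul (by fun_prop) (Measurable.div ?_ measurable_fst)
    exact (measurable_relaxationSpectrum ν).comp (by fun_prop)
  have hscale : ∀ x : ℝ, 0 < x → ∀ r : ℝ,
      x * G x (x * r) = Real.exp (-r * (x * t)) * relaxationSpectrum ν r := by
    intro x hx r
    simp only [hG]
    rw [mul_div_cancel_left₀ _ hx.ne']
    field_simp
  have hGi : ∀ x : ℝ, 0 < x → IntegrableOn (G x) (Ioi 0) := by
    intro x hx
    have h1 := integrableOn_Ioi_comp_mul_left_iff (G x) 0 hx
    rw [mul_zero] at h1
    refine h1.1 ?_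
    refine ((hM (x * t) (by positivity)).const_mul x⁻¹).congr (ae_of_all _ fun r => ?_)
    dsimp only
    rw [← hscale x hx, inv_mul_cancel_left₀ hx.ne']
  have hGv : ∀ x : ℝ, 0 < x → ∫ r in Ioi (0 : ℝ), G x r = relaxation ν (x * t) := by
    intro x hx
    have h1 := integral_comp_mul_left_Ioi' (G x) 0 hx
    rw [mul_zero, smul_eq_mul, ← integral_const_mul] at h1
    rw [← h1, relaxation_eq_laplace hν hν1 (mul_pos hx ht)]
    exact integral_congr_ae (ae_of_all _ fun r => hscale x hx r)
  have hprod : Integrable (Function.uncurry G)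
      ((ProbabilityTheory.betaMeasure 1 ν).prod (volume.restrict (Ioi (0 : ℝ)))) := by
    rw [integrable_prod_iff hGm.aestronglyMeasurable]
    constructor
    · filter_upwards [hae] with x hx using hGi x hx.1
    · have hc := continuous_relaxation hν
      refine Integrable.congr (f := fun x => relaxation ν (x * t)) ?_ ?_
      · refine Integrable.of_bound (C := B)
          (by fun_prop : Continuous fun x => relaxation ν (x * t)).aestronglyMeasurable ?_
        filter_upwards [hae] with x hx using hB _ (mul_pos hx.1 ht)
      · filter_upwards [hae] with x hx
        rw [← hGv x hx.1]
        refine setIntegral_congr_fun measurableSet_Ioi fun r hr => ?_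
        have h := relaxationSpectrum_nonneg hν hν1 (div_pos hr hx.1)
        have h0 := hx.1
        simp only [Function.uncurry_apply_pair, hG]
        rw [Real.norm_of_nonneg (by positivity)]
  have hin : ∀ r : ℝ, ∫ x, G x r ∂(ProbabilityTheory.betaMeasure 1 ν) =
      Real.exp (-r * t) * creepSpectrum ν r := fun r => integral_const_mul _ _
  constructor
  · exact hprod.integral_prod_right.congr (ae_of_all _ hin)
  · rw [rateOfCreep_eq_integral_relaxation hν ht, ← integral_congr_ae (ae_of_all _ hin),
      ← integral_integral_swap hprod]
    refine integral_congr_ae ?_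
    filter_upwards [hae] with x hx using (hGv x hx.1).symm

/-- In the coordinate `z = log s` the transform is `e^{νz} / e^z` times a Stieltjes transform at
`e^{νz}`. For `ν < 1` the latter point is off the negative half-line even when `Im z = ±π`. -/
noncomputable def logCreepTransform (ν : ℝ) (z : ℂ) : ℂ :=
  Complex.exp (ν * z) / Complex.exp z *
    ∫ x, (Complex.exp (ν * z) + ((x ^ ν : ℝ) : ℂ))⁻¹ ∂(ProbabilityTheory.betaMeasure 1 ν)

lemma creepTransform_exp {ν : ℝ} {z : ℂ} (hz : |z.im| < Real.pi) :
    creepTransform ν (Complex.exp z) = logCreepTransform ν z := by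
  rw [creepTransform, exp_cpow hz, logCreepTransform]

lemma abs_mul_lt_pi {ν : ℝ} (hν : 0 < ν) (hν1 : ν < 1) {y : ℝ} (hy : |y| ≤ Real.pi) :
    |ν * y| < Real.pi := by
  rw [abs_mul, abs_of_pos hν]
  nlinarith [abs_nonneg y, Real.pi_pos]

lemma continuousAt_logCreepTransform {ν : ℝ} (hν : 0 < ν) (hν1 : ν < 1) {z : ℂ}
    (hz : |z.im| ≤ Real.pi) : ContinuousAt (logCreepTransform ν) z := by
  have hmem : Complex.exp (ν * z) ∈ Complex.slitPlane :=
    exp_mem_slitPlane (by simpa using abs_mul_lt_pi hν hν1 hz)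
  have h1 : ContinuousAt (fun z : ℂ => Complex.exp (ν * z)) z := by fun_prop
  have h2 := ((differentiableOn_stieltjes_betaMeasure hν).2.differentiableAt
    (Complex.isOpen_slitPlane.mem_nhds hmem)).continuousAt
  refine (h1.div Complex.continuous_exp.continuousAt (Complex.exp_ne_zero z)).mul ?_
  exact ContinuousAt.comp (f := fun z : ℂ => Complex.exp (ν * z)) h2 h1

/-- The boundary values on the two sides of the cut; `ε = 1` is the upper and `ε = -1` the lower
side. -/
lemma im_logCreepTransform {ν : ℝ} (hν : 0 < ν) (hν1 : ν < 1) {r : ℝ} (hr : 0 < r) {ε : ℝ}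
    (hε : ε = 1 ∨ ε = -1) :
    (logCreepTransform ν (Real.log r + (ε * Real.pi : ℝ) * Complex.I)).im =
      -(ε * Real.pi * creepSpectrum ν r) := by
  have hpi := Real.pi_pos
  set φ := ν * Real.pi with hφ
  set a := r ^ ν with ha
  have ha0 : 0 < a := by positivity
  have hS := sin_mul_pi_pos hν hν1
  rw [← hφ] at hS
  have ha' : a = Real.exp (ν * Real.log r) := by rw [ha, Real.rpow_def_of_pos hr, mul_comm]
  have e1 : Complex.exp (Real.log r + (ε * Real.pi : ℝ) * Complex.I) = -(r : ℂ) := by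
    rw [Complex.exp_add, ← Complex.ofReal_exp, Real.exp_log hr]
    rcases hε with rfl | rfl
    · rw [one_mul, Complex.exp_pi_mul_I]; ring
    · rw [neg_one_mul, Complex.ofReal_neg, neg_mul, Complex.exp_neg, Complex.exp_pi_mul_I]
      norm_num
  have e2 : Complex.exp (ν * (Real.log r + (ε * Real.pi : ℝ) * Complex.I)) =
      a * (Real.cos φ + ε * Real.sin φ * Complex.I) := by
    rw [show (ν : ℂ) * (Real.log r + (ε * Real.pi : ℝ) * Complex.I) =
        ((ν * Real.log r : ℝ) : ℂ) + ((ε * φ : ℝ) : ℂ) * Complex.I by rw [hφ]; push_cast; ring,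
      Complex.exp_add, Complex.exp_mul_I, ← Complex.ofReal_exp, ← ha', ← Complex.ofReal_cos,
      ← Complex.ofReal_sin]
    rcases hε with rfl | rfl
    · simp
    · simp [Real.cos_neg, Real.sin_neg]
  have hmem : Complex.exp (ν * (Real.log r + (ε * Real.pi : ℝ) * Complex.I)) ∈
      Complex.slitPlane := by
    refine exp_mem_slitPlane ?_
    have := abs_mul_lt_pi hν hν1 (y := ε * Real.pi)
      (by rcases hε with rfl | rfl <;> simp [abs_of_pos hpi])
    simpa using this
  have hint := (differentiableOn_stieltjes_betaMeasure hν).1 _ hmem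
  have hint' := hint.const_mul (Complex.exp (ν * (Real.log r + (ε * Real.pi : ℝ) * Complex.I)) /
    Complex.exp (Real.log r + (ε * Real.pi : ℝ) * Complex.I))
  rw [logCreepTransform, ← integral_const_mul, creepSpectrum, ← integral_const_mul,
    ← integral_neg]
  refine (integral_im hint').symm.trans (integral_congr_ae ?_)
  filter_upwards [ae_betaMeasure 1 ν] with x hx
  have hx0 := hx.1
  have hy0 : 0 < x ^ ν := by positivity
  rw [e1, e2]
  rw [relaxationSpectrum, ← hφ, Real.div_rpow hr.le hx0.le, ← ha]
  set y := x ^ ν with hy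
  set S := Real.sin φ with hSdef
  set C := Real.cos φ with hCdef
  have hCS : S ^ 2 + C ^ 2 = 1 := Real.sin_sq_add_cos_sq φ
  have hε2 : ε ^ 2 = 1 := by rcases hε with rfl | rfl <;> norm_num
  have hD : 0 < a ^ 2 + 2 * a * y * C + y ^ 2 := by
    have : 0 < (a * S) ^ 2 := by positivity
    nlinarith [sq_nonneg (y + a * C)]
  have hnorm : Complex.normSq ((a : ℂ) * (C + ε * S * Complex.I) + y) =
      a ^ 2 + 2 * a * y * C + y ^ 2 := by
    rw [Complex.normSq_apply]
    simp
    linear_combination (a ^ 2) * hCS + a ^ 2 * S ^ 2 * hε2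
  have hD' : (a / y) ^ 2 + 2 * (a / y) * C + 1 = (a ^ 2 + 2 * a * y * C + y ^ 2) / y ^ 2 := by
    field_simp
  rw [hD']
  change ((a : ℂ) * (C + ε * S * Complex.I) / -(r : ℂ) *
    ((a : ℂ) * (C + ε * S * Complex.I) + y)⁻¹).im = _
  rw [div_mul_eq_mul_div, div_neg, Complex.neg_im, Complex.div_ofReal_im, Complex.mul_im,
    Complex.inv_re, Complex.inv_im, hnorm]
  generalize a ^ 2 + 2 * a * y * C + y ^ 2 = D at *
  simp
  field_simp
  ring

lemma ofReal_mul_exp {r : ℝ} (hr : 0 < r) (θ : ℝ) :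
    (r : ℂ) * Complex.exp (θ * Complex.I) = Complex.exp (Real.log r + θ * Complex.I) := by
  rw [Complex.exp_add, ← Complex.ofReal_exp, Real.exp_log hr]

lemma tendsto_im_creepTransform {ν : ℝ} (hν : 0 < ν) (hν1 : ν < 1) {r : ℝ} (hr : 0 < r) {ε : ℝ}
    (hε : ε = 1 ∨ ε = -1) :
    Tendsto (fun θ : ℝ => (creepTransform ν (r * Complex.exp ((ε * θ : ℝ) * Complex.I))).im)
      (𝓝[<] Real.pi) (𝓝 (-(ε * Real.pi * creepSpectrum ν r))) := by
  have hpi := Real.pi_pos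
  have habs : ∀ θ : ℝ, |ε * θ| = |θ| := fun θ => by rcases hε with rfl | rfl <;> simp
  have him : ∀ θ : ℝ, ((Real.log r : ℂ) + (ε * θ : ℝ) * Complex.I).im = ε * θ := fun θ => by simp
  rw [← im_logCreepTransform hν hν1 hr hε]
  have h1 := continuousAt_logCreepTransform hν hν1
    (z := Real.log r + (ε * Real.pi : ℝ) * Complex.I)
    (by rw [him, habs, abs_of_pos hpi])
  have h2 : Tendsto (fun θ : ℝ => (Real.log r : ℂ) + (ε * θ : ℝ) * Complex.I) (𝓝[<] Real.pi)
      (𝓝 (Real.log r + (ε * Real.pi : ℝ) * Complex.I)) :=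
    ((by fun_prop : Continuous fun θ : ℝ => (Real.log r : ℂ) + (ε * θ : ℝ) * Complex.I).tendsto
      _).mono_left nhdsWithin_le_nhds
  refine ((Complex.continuous_im.tendsto _).comp (h1.tendsto.comp h2)).congr' ?_
  filter_upwards [Ioo_mem_nhdsLT hpi] with θ hθ
  rw [ofReal_mul_exp hr, creepTransform_exp (by rw [him, habs, abs_of_pos hθ.1]; exact hθ.2)]
  rfl

/-! ### The classical Becker model `ν = 1` -/

/-- The frequency spectrum for `ν = 1`: the indicator of `(0, 1)`, with the mean value `1/2` at the
jump, as the Titchmarsh limit demands. -/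
noncomputable def beckerSpectrum (r : ℝ) : ℝ := if r < 1 then 1 else if r = 1 then 1 / 2 else 0

lemma beckerSpectrum_nonneg (r : ℝ) : 0 ≤ beckerSpectrum r := by
  unfold beckerSpectrum
  split_ifs <;> norm_num

lemma betaMeasure_one_one :
    ProbabilityTheory.betaMeasure 1 1 = volume.restrict (Ioo (0 : ℝ) 1) := by
  rw [← withDensity_indicator_one measurableSet_Ioo, ProbabilityTheory.betaMeasure]
  congr 1
  ext x
  have hb : ProbabilityTheory.beta 1 1 = 1 := by
    rw [ProbabilityTheory.beta, one_add_one_eq_two, Real.Gamma_two, Real.Gamma_one]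
    norm_num
  by_cases h : x ∈ Ioo (0 : ℝ) 1
  · rw [ProbabilityTheory.betaPDF_of_pos_lt_one h.1 h.2, hb, indicator_of_mem h]
    simp
  · rw [ProbabilityTheory.betaPDF_eq, if_neg (show ¬(0 < x ∧ x < 1) from h), indicator_of_notMem h,
      ENNReal.ofReal_zero]

lemma add_ofReal_mem_slitPlane {s : ℂ} (hs : s ∈ Complex.slitPlane) {x : ℝ} (hx : 0 ≤ x) :
    s + x ∈ Complex.slitPlane := by
  rcases hs with h | h
  · exact Or.inl (by simp; linarith)
  · exact Or.inr (by simpa using h)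

/-- For `ν = 1` the Beta law is uniform and the transform is elementary. -/
lemma creepTransform_one {s : ℂ} (hs : s ∈ Complex.slitPlane) :
    creepTransform 1 s = Complex.log (s + 1) - Complex.log s := by
  have h0 := Complex.slitPlane_ne_zero hs
  have hd : ∀ x ∈ uIcc (0 : ℝ) 1, HasDerivAt (fun x : ℝ => Complex.log (s + x)) (s + x)⁻¹ x := by
    intro x hx
    rw [uIcc_of_le zero_le_one] at hx
    have h1 : HasDerivAt (fun x : ℝ => s + (x : ℂ)) 1 x := by
      simpa using (Complex.ofRealCLM.hasDerivAt (x := x)).const_add s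
    simpa using h1.clog_real (add_ofReal_mem_slitPlane hs hx.1)
  have hc : ContinuousOn (fun x : ℝ => (s + (x : ℂ))⁻¹) (uIcc 0 1) := by
    refine ContinuousOn.inv₀ (by fun_prop) fun x hx => ?_
    rw [uIcc_of_le zero_le_one] at hx
    exact Complex.slitPlane_ne_zero (add_ofReal_mem_slitPlane hs hx.1)
  have h2 := intervalIntegral.integral_eq_sub_of_hasDerivAt hd hc.intervalIntegrable
  rw [intervalIntegral.integral_of_le zero_le_one, integral_Ioc_eq_integral_Ioo] at h2
  rw [creepTransform, betaMeasure_one_one]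
  simp only [Complex.ofReal_one, Complex.cpow_one, Real.rpow_one]
  rw [h2, div_self h0]
  simp

lemma one_add_mul_exp_im (r θ : ℝ) :
    (1 + (r : ℂ) * Complex.exp (θ * Complex.I)).im = r * Real.sin θ := by
  rw [Complex.add_im, Complex.one_im, zero_add, Complex.im_ofReal_mul, Complex.exp_ofReal_mul_I_im]

/-- The argument of `1 + r e^{iθ}` tends to `0`, `π/2` or `π` as `r` is less than, equal to or
greater than `1`. -/
lemma tendsto_arg_one_add {r : ℝ} (hr : 0 < r) :
    Tendsto (fun θ : ℝ => (1 + (r : ℂ) * Complex.exp (θ * Complex.I)).arg) (𝓝[<] Real.pi)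
      (𝓝 (Real.pi - Real.pi * beckerSpectrum r)) := by
  have hpi := Real.pi_pos
  have hval : 1 + (r : ℂ) * Complex.exp (Real.pi * Complex.I) = ((1 - r : ℝ) : ℂ) := by
    rw [Complex.exp_pi_mul_I]; push_cast; ring
  have hlim : Tendsto (fun θ : ℝ => 1 + (r : ℂ) * Complex.exp (θ * Complex.I)) (𝓝[<] Real.pi)
      (𝓝 ((1 - r : ℝ) : ℂ)) := by
    rw [← hval]
    exact ((by fun_prop : Continuous fun θ : ℝ => 1 + (r : ℂ) * Complex.exp (θ * Complex.I)).tendsto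
      _).mono_left nhdsWithin_le_nhds
  rcases lt_trichotomy r 1 with h | rfl | h
  · have hK : Real.pi - Real.pi * beckerSpectrum r = ((1 - r : ℝ) : ℂ).arg := by
      rw [beckerSpectrum, if_pos h, Complex.arg_ofReal_of_nonneg (by linarith)]; ring
    rw [hK]
    exact (Complex.continuousAt_arg (Or.inl (by simpa using h))).tendsto.comp hlim
  · -- on the unit circle `1 + e^{iθ} = 2 cos(θ/2) e^{iθ/2}`
    have hK : Real.pi - Real.pi * beckerSpectrum 1 = Real.pi / 2 := by
      rw [beckerSpectrum, if_neg (lt_irrefl _), if_pos rfl]; ring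
    rw [hK]
    have h1 : Tendsto (fun θ : ℝ => θ / 2) (𝓝[<] Real.pi) (𝓝 (Real.pi / 2)) :=
      ((by fun_prop : Continuous fun θ : ℝ => θ / 2).tendsto _).mono_left nhdsWithin_le_nhds
    refine h1.congr' ?_
    filter_upwards [Ioo_mem_nhdsLT hpi] with θ hθ
    have hcos : 0 < 2 * Real.cos (θ / 2) := by
      have := Real.cos_pos_of_mem_Ioo (x := θ / 2) ⟨by linarith [hθ.1], by linarith [hθ.2]⟩
      positivity
    have h2 : 1 + ((1 : ℝ) : ℂ) * Complex.exp (θ * Complex.I) = ((2 * Real.cos (θ / 2) : ℝ) : ℂ) *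
        (Complex.cos ((θ / 2 : ℝ) : ℂ) + Complex.sin ((θ / 2 : ℝ) : ℂ) * Complex.I) := by
      rw [← Complex.exp_mul_I]
      have h3 : Complex.exp (θ * Complex.I) = Complex.exp ((θ / 2 : ℝ) * Complex.I) *
          Complex.exp ((θ / 2 : ℝ) * Complex.I) := by
        rw [← Complex.exp_add]; congr 1; push_cast; ring
      have h4 : ((2 * Real.cos (θ / 2) : ℝ) : ℂ) = Complex.exp ((θ / 2 : ℝ) * Complex.I) +
          Complex.exp (-((θ / 2 : ℝ) * Complex.I)) := by
        push_cast
        rw [Complex.two_cos, neg_mul]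
      rw [h3, h4, add_mul, ← Complex.exp_add (-_)]
      simp
      ring
    rw [h2, Complex.arg_mul_cos_add_sin_mul_I hcos ⟨by linarith [hθ.1], by linarith [hθ.2]⟩]
  · have hK : Real.pi - Real.pi * beckerSpectrum r = Real.pi := by
      rw [beckerSpectrum, if_neg h.le.not_gt, if_neg h.ne']; ring
    rw [hK]
    refine (Complex.tendsto_arg_nhdsWithin_im_nonneg_of_re_neg_of_im_zero
      (z := ((1 - r : ℝ) : ℂ)) (by simpa using h) (Complex.ofReal_im _)).comp
      (tendsto_nhdsWithin_iff.2 ⟨hlim, ?_⟩)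
    filter_upwards [Ioo_mem_nhdsLT hpi] with θ hθ
    rw [one_add_mul_exp_im]
    have := Real.sin_pos_of_pos_of_lt_pi hθ.1 hθ.2
    positivity

lemma tendsto_im_creepTransform_one {r : ℝ} (hr : 0 < r) {ε : ℝ} (hε : ε = 1 ∨ ε = -1) :
    Tendsto (fun θ : ℝ => (creepTransform 1 (r * Complex.exp ((ε * θ : ℝ) * Complex.I))).im)
      (𝓝[<] Real.pi) (𝓝 (-(ε * Real.pi * beckerSpectrum r))) := by
  have hpi := Real.pi_pos
  have h1 : Tendsto (fun θ : ℝ => ε * ((1 + (r : ℂ) * Complex.exp (θ * Complex.I)).arg - θ))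
      (𝓝[<] Real.pi) (𝓝 (ε * ((Real.pi - Real.pi * beckerSpectrum r) - Real.pi))) :=
    ((tendsto_arg_one_add hr).sub (tendsto_id.mono_left nhdsWithin_le_nhds)).const_mul ε
  rw [show -(ε * Real.pi * beckerSpectrum r) =
    ε * ((Real.pi - Real.pi * beckerSpectrum r) - Real.pi) by ring]
  refine h1.congr' ?_
  filter_upwards [Ioo_mem_nhdsLT hpi] with θ hθ
  have habs : |ε * θ| < Real.pi := by
    rcases hε with rfl | rfl <;> simpa [abs_of_pos hθ.1] using hθ.2
  obtain ⟨hl, hu⟩ := abs_lt.1 habs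
  have hmem : (r : ℂ) * Complex.exp ((ε * θ : ℝ) * Complex.I) ∈ Complex.slitPlane := by
    rw [ofReal_mul_exp hr]
    exact exp_mem_slitPlane (by simpa using habs)
  have harg : ((r : ℂ) * Complex.exp ((ε * θ : ℝ) * Complex.I)).arg = ε * θ := by
    rw [Complex.exp_mul_I, Complex.arg_mul_cos_add_sin_mul_I hr ⟨hl, hu.le⟩]
  rw [creepTransform_one hmem, Complex.sub_im, Complex.log_im, Complex.log_im, harg, add_comm _ 1]
  rcases hε with rfl | rfl
  · rw [one_mul, one_mul]
  · -- the lower side is the complex conjugate of the upper one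
    have hconj : 1 + (r : ℂ) * Complex.exp ((-1 * θ : ℝ) * Complex.I) =
        (starRingEnd ℂ) (1 + (r : ℂ) * Complex.exp (θ * Complex.I)) := by
      simp [← Complex.exp_conj]
    have hne : (1 + (r : ℂ) * Complex.exp (θ * Complex.I)).arg ≠ Real.pi := by
      intro h
      have h2 := (Complex.arg_eq_pi_iff.1 h).2
      rw [one_add_mul_exp_im] at h2
      have := Real.sin_pos_of_pos_of_lt_pi hθ.1 hθ.2
      have : 0 < r * Real.sin θ := by positivity
      linarith
    rw [hconj, Complex.arg_conj, if_neg hne]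
    ring

lemma laplace_beckerSpectrum {t : ℝ} (ht : 0 < t) :
    IntegrableOn (fun r => Real.exp (-r * t) * beckerSpectrum r) (Ioi 0) ∧
      rateOfCreep 1 t = ∫ r in Ioi (0 : ℝ), Real.exp (-r * t) * beckerSpectrum r := by
  have hae : (Iio (1 : ℝ)).indicator (fun r => Real.exp (-r * t)) =ᵐ[volume.restrict (Ioi 0)]
      fun r => Real.exp (-r * t) * beckerSpectrum r := by
    refine ae_restrict_of_ae ?_
    filter_upwards [compl_mem_ae_iff.2 (measure_singleton (1 : ℝ))] with r hr
    have hr1 : r ≠ 1 := hr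
    by_cases h : r < 1
    · rw [indicator_of_mem (show r ∈ Iio 1 from h), beckerSpectrum, if_pos h, mul_one]
    · rw [indicator_of_notMem (show r ∉ Iio 1 from h), beckerSpectrum, if_neg h, if_neg hr1,
        mul_zero]
  have hset : Iio (1 : ℝ) ∩ Ioi 0 = Ioo 0 1 := by rw [inter_comm, Ioi_inter_Iio]
  constructor
  · refine Integrable.congr ?_ hae
    rw [integrable_indicator_iff measurableSet_Iio, IntegrableOn,
      Measure.restrict_restrict measurableSet_Iio, hset]
    exact (Continuous.integrableOn_Icc (by fun_prop)).mono_set Ioo_subset_Icc_self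
  · rw [rateOfCreep_eq_integral_relaxation one_pos ht, betaMeasure_one_one,
      ← integral_congr_ae hae, integral_indicator measurableSet_Iio,
      Measure.restrict_restrict measurableSet_Iio, hset]
    simp [relaxation_one]

/-! ### Creep function and spectra -/

/-- The spectrum of the rate of creep exists, is non-negative and represents the rate of creep. The
two limits in the Titchmarsh formula are treated together, with the sign `ε` of the argument. -/
lemma exists_isFrequencySpectrum {ν : ℝ} (hν : 0 < ν) (hν1 : ν ≤ 1) :
    ∃ K : ℝ → ℝ, IsFrequencySpectrum (rateOfCreep ν) K ∧ (∀ r : ℝ, 0 < r → 0 ≤ K r) ∧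
      ∀ t : ℝ, 0 < t → IntegrableOn (fun r => Real.exp (-r * t) * K r) (Ioi 0) ∧
        rateOfCreep ν t = ∫ r in Ioi (0 : ℝ), Real.exp (-r * t) * K r := by
  have hF := isContinuedLaplace_creepTransform hν hν1
  have hspec : ∀ K : ℝ → ℝ, (∀ r : ℝ, 0 < r → ∀ ε : ℝ, (ε = 1 ∨ ε = -1) →
      Tendsto (fun θ : ℝ => (creepTransform ν (r * Complex.exp ((ε * θ : ℝ) * Complex.I))).im)
        (𝓝[<] Real.pi) (𝓝 (-(ε * Real.pi * K r)))) → IsFrequencySpectrum (rateOfCreep ν) K := by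
    intro K h
    refine ⟨creepTransform ν, hF, fun r hr => ⟨?_, ?_⟩⟩
    · have h1 := (h r hr (-1) (Or.inr rfl)).const_mul (1 / Real.pi)
      rw [show 1 / Real.pi * -(-1 * Real.pi * K r) = K r by field_simp] at h1
      simpa using h1
    · have h1 := (h r hr 1 (Or.inl rfl)).const_mul (-(1 / Real.pi))
      rw [show -(1 / Real.pi) * -(1 * Real.pi * K r) = K r by field_simp] at h1
      simpa using h1
  rcases hν1.lt_or_eq with h | rfl
  · exact ⟨creepSpectrum ν, hspec _ fun r hr ε hε => tendsto_im_creepTransform hν h hr hε,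
      fun r hr => creepSpectrum_nonneg hν h hr, fun t ht => laplace_creepSpectrum hν h ht⟩
  · exact ⟨beckerSpectrum, hspec _ fun r hr ε hε => tendsto_im_creepTransform_one hr hε,
      fun r _ => beckerSpectrum_nonneg r, fun t ht => laplace_beckerSpectrum ht⟩

lemma intervalIntegrable_rateOfCreep {ν : ℝ} (hν : 0 < ν) (hν1 : ν ≤ 1) {t : ℝ} (ht : 0 ≤ t) :
    IntervalIntegrable (rateOfCreep ν) volume 0 t := by
  obtain ⟨B, hB⟩ := exists_bound_rateOfCreep hν hν1
  rw [intervalIntegrable_iff_integrableOn_Ioc_of_le ht]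
  refine IntegrableOn.of_bound (C := B) (by simp)
    (((continuousOn_rateOfCreep hν).mono Ioc_subset_Ioi_self).aestronglyMeasurable
      measurableSet_Ioc) ?_
  exact (ae_restrict_iff' measurableSet_Ioc).2 (ae_of_all _ fun x hx => hB x hx.1)

lemma creep_eq_integral (ν t : ℝ) : creep ν t = ∫ u in (0 : ℝ)..t, rateOfCreep ν u := by
  rw [creep, ein, ← intervalIntegral.integral_const_mul]
  simp only [rateOfCreep, mul_div_assoc]

lemma hasDerivAt_creep {ν : ℝ} (hν : 0 < ν) (hν1 : ν ≤ 1) {t : ℝ} (ht : 0 < t) :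
    HasDerivAt (creep ν) (rateOfCreep ν t) t := by
  have hc := continuousOn_rateOfCreep hν
  rw [funext (creep_eq_integral ν)]
  exact intervalIntegral.integral_hasDerivAt_right (intervalIntegrable_rateOfCreep hν hν1 ht.le)
    (hc.stronglyMeasurableAtFilter isOpen_Ioi t ht) (hc.continuousAt (Ioi_mem_nhds ht))

lemma IsCompletelyMonotone.congr {f g : ℝ → ℝ} (hf : IsCompletelyMonotone f)
    (h : EqOn g f (Ioi 0)) : IsCompletelyMonotone g := by
  refine ⟨hf.1.congr h, fun n t ht => ?_⟩
  rw [(h.eventuallyEq_of_mem (Ioi_mem_nhds ht)).iteratedDeriv_eq]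
  exact hf.2 n t ht

lemma isBernstein_creep {ν : ℝ} (hν : 0 < ν) (hν1 : ν ≤ 1)
    (hcm : IsCompletelyMonotone (rateOfCreep ν)) : IsBernstein (creep ν) := by
  have hderiv : EqOn (deriv (creep ν)) (rateOfCreep ν) (Ioi 0) := fun t ht =>
    (hasDerivAt_creep hν hν1 ht).deriv
  refine ⟨?_, fun t ht => ?_, hcm.congr hderiv⟩
  · rw [contDiffOn_infty_iff_deriv_of_isOpen isOpen_Ioi]
    exact ⟨fun t ht => (hasDerivAt_creep hν hν1 ht).differentiableAt.differentiableWithinAt,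
      hcm.1.congr hderiv⟩
  · rw [creep_eq_integral, intervalIntegral.integral_of_le ht.le]
    refine setIntegral_nonneg measurableSet_Ioc fun u hu => ?_
    simpa using hcm.2 0 u hu.1

end GeneralizedBecker

theorem mainTheorem1 (ν : ℝ) (hν0 : 0 < ν) (hν1 : ν ≤ 1) :
    GeneralizedBecker.IsCompletelyMonotone (GeneralizedBecker.rateOfCreep ν) ∧
    (∀ t : ℝ, 0 < t →
      HasDerivAt (GeneralizedBecker.creep ν) (GeneralizedBecker.rateOfCreep ν t) t) ∧
    GeneralizedBecker.IsBernstein (GeneralizedBecker.creep ν) ∧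
    (∃ K : ℝ → ℝ, GeneralizedBecker.IsFrequencySpectrum (GeneralizedBecker.rateOfCreep ν) K) ∧
    ∀ K : ℝ → ℝ, GeneralizedBecker.IsFrequencySpectrum (GeneralizedBecker.rateOfCreep ν) K →
      (∀ r : ℝ, 0 < r → 0 ≤ K r) ∧
      (∀ τ : ℝ, 0 < τ → 0 ≤ GeneralizedBecker.timeSpectrum K τ) ∧
      ∀ t : ℝ, 0 < t →
        (IntegrableOn (fun r : ℝ => Real.exp (-r * t) * K r) (Ioi 0) ∧
          GeneralizedBecker.rateOfCreep ν t =
            ∫ r in Ioi (0 : ℝ), Real.exp (-r * t) * K r) ∧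
        (IntegrableOn
            (fun τ : ℝ => Real.exp (-t / τ) * GeneralizedBecker.timeSpectrum K τ) (Ioi 0) ∧
          GeneralizedBecker.rateOfCreep ν t =
            ∫ τ in Ioi (0 : ℝ), Real.exp (-t / τ) * GeneralizedBecker.timeSpectrum K τ) := by
  obtain ⟨L, hL, hL0, hLf⟩ := GeneralizedBecker.exists_isFrequencySpectrum hν0 hν1
  have hcm := GeneralizedBecker.isCompletelyMonotone_of_eq_laplace hL0
    (fun t ht => (hLf t ht).1) (fun t ht => (hLf t ht).2)
  refine ⟨hcm, fun t ht => GeneralizedBecker.hasDerivAt_creep hν0 hν1 ht,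
    GeneralizedBecker.isBernstein_creep hν0 hν1 hcm, ⟨L, hL⟩, fun K hK => ?_⟩
  have hKL := hK.eqOn hL
  have hK0 : ∀ r : ℝ, 0 < r → 0 ≤ K r := fun r hr => by
    rw [hKL hr]
    exact hL0 r hr
  refine ⟨hK0, fun τ hτ => div_nonneg (hK0 _ (by positivity)) (by positivity), fun t ht => ?_⟩
  have hcongr : EqOn (fun r : ℝ => Real.exp (-r * t) * L r)
      (fun r : ℝ => Real.exp (-r * t) * K r) (Ioi 0) := fun r hr => by
    dsimp only
    rw [hKL hr]
  have hi := (integrableOn_congr_fun hcongr measurableSet_Ioi).1 (hLf t ht).1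
  have hv := (hLf t ht).2.trans (setIntegral_congr_fun measurableSet_Ioi hcongr)
  obtain ⟨h1, h2⟩ := GeneralizedBecker.laplace_timeSpectrum K t
  exact ⟨⟨hi, hv⟩, h1.2 hi, hv.trans h2.symm⟩
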